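/- Let $N\ge 2$, let $\Omega\subset\mathbb R^N$ be a smooth bounded domain, let $s\in(0,1)$ and $\lambda>0$. Assume: * $p\in C(\overline\Omega\times\overline\Omega,\mathbb R)$ is symmetric, $p^-:=\min p>1$, and $N>s\,p(x,y)$ for all $(x,y)\in\overline\Omega\times\overline\Omega$; * $q\in C(\overline\Omega,\mathbb R)$ and $q^-:=\min q>1$; * $\gamma\in C(\overline\Omega,\mathbb R)$ and $0<\gamma^-:=\min\gamma\le\gamma^+:=\max\gamma<1$; * $f\in C(\overline\Omega\times\mathbb R,\mathbb R)$, and there are $\delta,\delta'>0$ and $\alpha\in C(\overline\Omega,\mathbb R)$ with $1<\alpha^-:=\min\alpha\le\alpha^+:=\max\alpha<p^-$, $1-\gamma^-<\alpha^-$ and $1-\gamma(x)<\alpha(x)$ such that $f(x,-t)=-f(x,t)$ for all $x\in\Omega$, $|t|\le\delta$; $\lim_{t\to0}\frac{f(x,t)}{|t|^{p^--2}t}=+\infty$ uniformly in $x\in\Omega$; and $t f(x,t)\le\alpha(x)\int_0^t f(x,\tau)\,d\tau$ for all $x\in\Omega$, $|t|\le\delta'$. Let $0<l\le\frac12\min\{\delta,\delta'\}$,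 let $\xi\in C^1(\mathbb R)$ satisfy $0\le\xi\le1$, $\xi(t)=1$ for $|t|\le l$, $\xi(t)=0$ for $|t|\ge2l$, with $\xi$ non-increasing on $[l,2l]$ and non-decreasing on $[-2l,-l]$, and put $\bar f(x,t)=f(x,t)\xi(t)$. Let $W$ be the space of all $u\in L^{q(x)}(\Omega)$ (that is, $u$ measurable with $\int_\Omega|u|^{q(x)}\,dx<\infty$) such that $\iint_{\Omega\times\Omega}\frac{|u(x)-u(y)|^{p(x,y)}}{\mu^{p(x,y)}|x-y|^{N+sp(x,y)}}\,dx\,dy<\infty$ for some $\mu>0$, with the norm $$\|u\|_W=\inf\Big\{\mu>0:\int_\Omega\Big|\frac{u(x)}{\mu}\Big|^{q(x)}dx\le1\Big\}+\inf\Big\{\mu>0:\iint_{\Omega\times\Omega}\frac{|u(x)-u(y)|^{p(x,y)}}{\mu^{p(x,y)}|x-y|^{N+sp(x,y)}}\,dx\,dy<1\Big\},$$ and let $W_0$ be the closure of $C_c^\infty(\Omega)$ in $W$. Let $u\in W_0$ be a weak solution of the cut-off problem $$(-\Delta)^s_{p(\cdot)}u=\frac{\lambda}{|u|^{\gamma(x)-1}u}+\bar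 f(x,u)\ \text{ in }\Omega,\qquad u=0\ \text{ in }\mathbb R^N\setminus\Omega,$$ meaning that for every $\phi\in W_0$ one has $\phi/|u|^{\gamma(\cdot)}\in L^1(\Omega)$ and $$\iint_{\Omega\times\Omega}\frac{|u(x)-u(y)|^{p(x,y)-2}(u(x)-u(y))(\phi(x)-\phi(y))}{|x-y|^{N+sp(x,y)}}\,dx\,dy-\int_\Omega\Big(\frac{\lambda}{|u|^{\gamma(x)-1}u}+\bar f(x,u)\Big)\phi\,dx=0.$$ Then $u\in L^\infty(\Omega)$. -/

import Mathlib

namespace VarExpFrac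

open MeasureTheory Set Topology
open scoped ENNReal ContDiff

noncomputable section

/-- A smooth bounded domain of `ℝ^N`: a non-empty, connected, bounded open set whose boundary is
locally the regular zero level of a smooth function, with the set lying on its negative side. -/
structure IsSmoothBoundedDomain {N : ℕ} (Ω : Set (EuclideanSpace ℝ (Fin N))) : Prop where
  isOpen : IsOpen Ω
  isConnected : IsConnected Ω
  isBounded : Bornology.IsBounded Ω
  smooth_boundary : ∀ x₀ ∈ frontier Ω, ∃ U ∈ 𝓝 x₀, ∃ ρ : EuclideanSpace ℝ (Fin N) → ℝ,
    ContDiff ℝ ∞ ρ ∧ fderiv ℝ ρ x₀ ≠ 0 ∧ ∀ x ∈ U, (x ∈ Ω ↔ ρ x < 0)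

/-- `g⁻`, the minimum of `g` over `closure Ω` (attained for `g` continuous on the non-empty compact
set `closure Ω`). -/
def lo {N : ℕ} (Ω : Set (EuclideanSpace ℝ (Fin N))) (g : EuclideanSpace ℝ (Fin N) → ℝ) : ℝ :=
  sInf (g '' closure Ω)

/-- `g⁺`, the maximum of `g` over `closure Ω`. -/
def hi {N : ℕ} (Ω : Set (EuclideanSpace ℝ (Fin N))) (g : EuclideanSpace ℝ (Fin N) → ℝ) : ℝ :=
  sSup (g '' closure Ω)

/-- `p⁻`, the minimum of `p` over `closure Ω × closure Ω`. -/
def lo₂ {N : ℕ} (Ω : Set (EuclideanSpace ℝ (Fin N)))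
    (p : EuclideanSpace ℝ (Fin N) → EuclideanSpace ℝ (Fin N) → ℝ) : ℝ :=
  sInf (Function.uncurry p '' (closure Ω ×ˢ closure Ω))

/-- The assumptions on the exponent `p`. The finiteness of the maximum `p⁺` is automatic, as `p` is
real-valued and continuous on a compact set. -/
structure AssumptionP {N : ℕ} (Ω : Set (EuclideanSpace ℝ (Fin N)))
    (p : EuclideanSpace ℝ (Fin N) → EuclideanSpace ℝ (Fin N) → ℝ) : Prop where
  continuousOn : ContinuousOn (Function.uncurry p) (closure Ω ×ˢ closure Ω)
  symm : ∀ x ∈ closure Ω, ∀ y ∈ closure Ω, p x y = p y x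
  one_lt : 1 < lo₂ Ω p

/-- The assumptions on the exponent `q`. -/
structure AssumptionQ {N : ℕ} (Ω : Set (EuclideanSpace ℝ (Fin N)))
    (q : EuclideanSpace ℝ (Fin N) → ℝ) : Prop where
  continuousOn : ContinuousOn q (closure Ω)
  one_lt : 1 < lo Ω q

/-- The assumptions on the singular exponent `γ`. -/
structure AssumptionG {N : ℕ} (Ω : Set (EuclideanSpace ℝ (Fin N)))
    (γ : EuclideanSpace ℝ (Fin N) → ℝ) : Prop where
  continuousOn : ContinuousOn γ (closure Ω)
  pos : 0 < lo Ω γ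
  lt_one : hi Ω γ < 1

/-- The assumptions on the nonlinearity `f`, with the exponent `α` and the numbers `δ, δ'` whose
existence they assert. The quotient `f(x,t) / t^(p⁻-1)` is read, for negative `t`, with the odd
power `|t|^(p⁻-2) t`. -/
structure AssumptionF {N : ℕ} (Ω : Set (EuclideanSpace ℝ (Fin N)))
    (p : EuclideanSpace ℝ (Fin N) → EuclideanSpace ℝ (Fin N) → ℝ)
    (γ : EuclideanSpace ℝ (Fin N) → ℝ) (f : EuclideanSpace ℝ (Fin N) → ℝ → ℝ)
    (α : EuclideanSpace ℝ (Fin N) → ℝ) (δ δ' : ℝ) : Prop where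
  continuousOn : ContinuousOn (Function.uncurry f) (closure Ω ×ˢ univ)
  delta_pos : 0 < δ
  odd : ∀ x ∈ Ω, ∀ t : ℝ, |t| ≤ δ → f x (-t) = -f x t
  sublinear : ∀ M : ℝ, ∃ η > 0, ∀ x ∈ Ω, ∀ t : ℝ, t ≠ 0 → |t| < η →
    M < f x t / (|t| ^ (lo₂ Ω p - 2) * t)
  delta'_pos : 0 < δ'
  alpha_continuousOn : ContinuousOn α (closure Ω)
  alpha_mem : ∀ x ∈ closure Ω, α x ∈ Ioo (1 - γ x) (lo₂ Ω p)
  alpha_lo : 1 - lo Ω γ < lo Ω α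
  one_lt_alpha : 1 < lo Ω α
  alpha_hi : hi Ω α < lo₂ Ω p
  le_primitive : ∀ x ∈ Ω, ∀ t : ℝ, |t| ≤ δ' → t * f x t ≤ α x * ∫ τ in (0 : ℝ)..t, f x τ

/-- The variable exponent Lebesgue space `L^{q(x)}(Ω)`. Functions on `Ω` are represented by functions
on the whole space; only their values on `Ω`, up to null sets, matter. -/
def MemLq {N : ℕ} (Ω : Set (EuclideanSpace ℝ (Fin N))) (q : EuclideanSpace ℝ (Fin N) → ℝ)
    (u : EuclideanSpace ℝ (Fin N) → ℝ) : Prop :=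
  AEStronglyMeasurable u (volume.restrict Ω) ∧
    ∫⁻ x in Ω, ENNReal.ofReal (|u x| ^ q x) < ⊤

/-- The Luxemburg norm of `L^{q(x)}(Ω)`. -/
def luxNorm {N : ℕ} (Ω : Set (EuclideanSpace ℝ (Fin N))) (q : EuclideanSpace ℝ (Fin N) → ℝ)
    (u : EuclideanSpace ℝ (Fin N) → ℝ) : ℝ≥0∞ :=
  ⨅ (μ : ℝ) (_ : 0 < μ ∧ ∫⁻ x in Ω, ENNReal.ofReal (|u x / μ| ^ q x) ≤ 1), ENNReal.ofReal μ

/-- The Gagliardo modular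
`∬_{Ω×Ω} |u(x)-u(y)|^{p(x,y)} / (μ^{p(x,y)} |x-y|^{N+s p(x,y)}) dx dy`. -/
def gagliardo {N : ℕ} (Ω : Set (EuclideanSpace ℝ (Fin N))) (s : ℝ)
    (p : EuclideanSpace ℝ (Fin N) → EuclideanSpace ℝ (Fin N) → ℝ)
    (u : EuclideanSpace ℝ (Fin N) → ℝ) (μ : ℝ) : ℝ≥0∞ :=
  ∫⁻ z in Ω ×ˢ Ω, ENNReal.ofReal
    (|u z.1 - u z.2| ^ p z.1 z.2 / (μ ^ p z.1 z.2 * ‖z.1 - z.2‖ ^ ((N : ℝ) + s * p z.1 z.2)))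

/-- The Gagliardo semi-norm. -/
def seminorm {N : ℕ} (Ω : Set (EuclideanSpace ℝ (Fin N))) (s : ℝ)
    (p : EuclideanSpace ℝ (Fin N) → EuclideanSpace ℝ (Fin N) → ℝ)
    (u : EuclideanSpace ℝ (Fin N) → ℝ) : ℝ≥0∞ :=
  ⨅ (μ : ℝ) (_ : 0 < μ ∧ gagliardo Ω s p u μ < 1), ENNReal.ofReal μ

/-- The space `W = W^{s,q(x),p(x,y)}(Ω)`. -/
def MemW {N : ℕ} (Ω : Set (EuclideanSpace ℝ (Fin N))) (s : ℝ) (q : EuclideanSpace ℝ (Fin N) → ℝ)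
    (p : EuclideanSpace ℝ (Fin N) → EuclideanSpace ℝ (Fin N) → ℝ)
    (u : EuclideanSpace ℝ (Fin N) → ℝ) : Prop :=
  MemLq Ω q u ∧ ∃ μ : ℝ, 0 < μ ∧ gagliardo Ω s p u μ < ⊤

/-- The norm of `W`. -/
def normW {N : ℕ} (Ω : Set (EuclideanSpace ℝ (Fin N))) (s : ℝ) (q : EuclideanSpace ℝ (Fin N) → ℝ)
    (p : EuclideanSpace ℝ (Fin N) → EuclideanSpace ℝ (Fin N) → ℝ)
    (u : EuclideanSpace ℝ (Fin N) → ℝ) : ℝ≥0∞ :=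
  luxNorm Ω q u + seminorm Ω s p u

/-- `φ ∈ C_c^∞(Ω)`. -/
def IsTestFunction {N : ℕ} (Ω : Set (EuclideanSpace ℝ (Fin N)))
    (φ : EuclideanSpace ℝ (Fin N) → ℝ) : Prop :=
  ContDiff ℝ ∞ φ ∧ HasCompactSupport φ ∧ tsupport φ ⊆ Ω

/-- The space `W₀`, the closure of `C_c^∞(Ω)` in `W`. -/
def MemW₀ {N : ℕ} (Ω : Set (EuclideanSpace ℝ (Fin N))) (s : ℝ) (q : EuclideanSpace ℝ (Fin N) → ℝ)
    (p : EuclideanSpace ℝ (Fin N) → EuclideanSpace ℝ (Fin N) → ℝ)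
    (u : EuclideanSpace ℝ (Fin N) → ℝ) : Prop :=
  MemW Ω s q p u ∧ ∀ ε : ℝ≥0∞, 0 < ε →
    ∃ φ : EuclideanSpace ℝ (Fin N) → ℝ, IsTestFunction Ω φ ∧ normW Ω s q p (fun x => u x - φ x) < ε

/-- The admissible cut-off functions `ξ` at level `l`. -/
structure IsCutoff (l : ℝ) (ξ : ℝ → ℝ) : Prop where
  contDiff : ContDiff ℝ 1 ξ
  mem_Icc : ∀ t, ξ t ∈ Icc (0 : ℝ) 1
  eq_one : ∀ t, |t| ≤ l → ξ t = 1
  eq_zero : ∀ t, 2 * l ≤ |t| → ξ t = 0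
  antitoneOn : AntitoneOn ξ (Icc l (2 * l))
  monotoneOn : MonotoneOn ξ (Icc (-(2 * l)) (-l))

/-- `u ∈ W₀` is a weak solution of
`(-Δ)^s_{p(·)} u = λ / (|u|^{γ(x)-1} u) + g(x,u)` in `Ω`, `u = 0` outside `Ω`.
The requirement `φ / |u|^{γ} ∈ L¹(Ω)` is expressed with values in `[0,∞]`, where `c / 0 = ∞` for
`c ≠ 0`; hence it forces `u ≠ 0` almost everywhere in `Ω`. -/
def IsWeakSolution {N : ℕ} (Ω : Set (EuclideanSpace ℝ (Fin N))) (s : ℝ)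
    (q : EuclideanSpace ℝ (Fin N) → ℝ)
    (p : EuclideanSpace ℝ (Fin N) → EuclideanSpace ℝ (Fin N) → ℝ)
    (γ : EuclideanSpace ℝ (Fin N) → ℝ) (lam : ℝ) (g : EuclideanSpace ℝ (Fin N) → ℝ → ℝ)
    (u : EuclideanSpace ℝ (Fin N) → ℝ) : Prop :=
  MemW₀ Ω s q p u ∧ ∀ φ : EuclideanSpace ℝ (Fin N) → ℝ, MemW₀ Ω s q p φ →
    ∫⁻ x in Ω, ENNReal.ofReal |φ x| / ENNReal.ofReal |u x| ^ γ x < ⊤ ∧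
    (∫ z in Ω ×ˢ Ω, |u z.1 - u z.2| ^ (p z.1 z.2 - 2) * (u z.1 - u z.2) * (φ z.1 - φ z.2) /
        ‖z.1 - z.2‖ ^ ((N : ℝ) + s * p z.1 z.2)) -
      ∫ x in Ω, (lam / (|u x| ^ (γ x - 1) * u x) + g x (u x)) * φ x = 0

end

end VarExpFrac

/-!
Boundedness of `u` is proved by a De Giorgi iteration that uses no Sobolev embedding.

Where `|u|` is large the cut-off nonlinearity vanishes and the singular term is at most `lam`. Let
`w = truncation k τ ∘ u`, a smooth version of `sign u * max (|u| - k) 0`. Since `w` is again the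
limit of test functions (`MemW₀.comp_left`), it is admissible in the equation, and for large `k`
this gives `∬ |w x - w y| ^ p / ‖x - y‖ ^ (N + s p) ≤ lam * ∫ |w|`
(`IsWeakSolution.gagliardo_comp_le`).

For the converse bound, `w` vanishes off `A = {|u| > k}`. A smooth bounded domain has measure
density: `|B(x, r) ∩ Ω| ≥ c r ^ N` for small `r` (`IsSmoothBoundedDomain.exists_measure_density`).
If `|A| ≤ (c / 2) r ^ N`, every ball `B(x, r)` with `x ∈ A` contains at least `(c / 2) r ^ N` of
`Ω \ A`. For `y` in this part of the ball `|w x - w y| = |w x|`, and the variable exponent is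
disposed of by the elementary bound `t ^ p ≥ τ ^ (P - 1) * (t - τ)`, valid for `t ≥ τ`, `1 ≤ p ≤ P`
and `τ ≤ 1`. The double integral over `x ∈ A`, `y ∈ B(x, r) ∩ Ω \ A` is therefore at least
`τ ^ (P - 1) * (c / 2) * r ^ (-s) * ∫ (|w| - τ)₊` (`mul_lintegral_le_gagliardo`).

For `τ` of the order of `r ^ (s / (P - 1))` the two estimates combine to `∫ |w| ≤ 2 τ |A|`. Hence
raising the level by a multiple of `τ` reduces `|A|` below `(c / 2) (r / 2) ^ N`
(`measure_superlevel_step`). Along the radii `r₁ / 2 ^ n` the increments of the level are summable,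
so `{|u| > M}` is null for some finite `M` (`exists_ae_abs_le_of_gagliardo_le`).
-/

namespace VarExpFrac

open MeasureTheory Set Topology
open scoped ENNReal ContDiff

noncomputable section

/-! ### Bounds on the exponents -/

lemma lo_le {N : ℕ} {Ω : Set (EuclideanSpace ℝ (Fin N))} (hΩ : Bornology.IsBounded Ω)
    {g : EuclideanSpace ℝ (Fin N) → ℝ} (hg : ContinuousOn g (closure Ω)) {x} (hx : x ∈ closure Ω) :
    lo Ω g ≤ g x :=
  csInf_le (hΩ.isCompact_closure.image_of_continuousOn hg).bddBelow (mem_image_of_mem _ hx)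

lemma AssumptionP.exists_bounds {N : ℕ} {Ω : Set (EuclideanSpace ℝ (Fin N))}
    {p : EuclideanSpace ℝ (Fin N) → EuclideanSpace ℝ (Fin N) → ℝ} (hP : AssumptionP Ω p)
    (hΩ : Bornology.IsBounded Ω) :
    ∃ P : ℝ, 1 < P ∧ ∀ x ∈ Ω, ∀ y ∈ Ω, 1 ≤ p x y ∧ p x y ≤ P := by
  have hK : IsCompact (Function.uncurry p '' (closure Ω ×ˢ closure Ω)) :=
    (hΩ.isCompact_closure.prod hΩ.isCompact_closure).image_of_continuousOn hP.continuousOn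
  obtain ⟨P, hPb⟩ := hK.bddAbove
  refine ⟨max P 2, lt_max_of_lt_right (by norm_num), fun x hx y hy => ?_⟩
  have hmem : p x y ∈ Function.uncurry p '' (closure Ω ×ˢ closure Ω) :=
    ⟨(x, y), ⟨subset_closure hx, subset_closure hy⟩, rfl⟩
  exact ⟨hP.one_lt.le.trans (csInf_le hK.bddBelow hmem), (hPb hmem).trans (le_max_left _ _)⟩

/-! ### Interior balls and measure density of smooth bounded domains -/

/-- Near a boundary point the domain contains, with each of its points, a truncated cone of
directions of descent of the defining function, hence a ball of comparable size. -/
lemma IsSmoothBoundedDomain.exists_ball_subset_nhds {N : ℕ} {Ω : Set (EuclideanSpace ℝ (Fin N))}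
    (hΩ : IsSmoothBoundedDomain Ω) {x₀ : EuclideanSpace ℝ (Fin N)} (hx₀ : x₀ ∈ closure Ω) :
    ∃ V ∈ 𝓝 x₀, ∃ κ > 0, ∃ r₀ > 0, ∀ x ∈ V ∩ Ω, ∀ r, 0 < r → r ≤ r₀ →
      ∃ z, Metric.ball z (κ * r) ⊆ Metric.ball x r ∩ Ω := by
  by_cases hmem : x₀ ∈ Ω
  · obtain ⟨η, hη, hsub⟩ := Metric.isOpen_iff.1 hΩ.isOpen x₀ hmem
    refine ⟨Metric.ball x₀ (η / 2), Metric.ball_mem_nhds _ (half_pos hη), 1, one_pos, η / 2,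
      half_pos hη, fun x hx r hr hr' => ⟨x, subset_inter (by rw [one_mul]) fun y hy => hsub ?_⟩⟩
    have h1 := hx.1
    rw [Metric.mem_ball] at *
    linarith [dist_triangle y x x₀]
  · obtain ⟨U, hU, ρ, hρ, hd, hiff⟩ := hΩ.smooth_boundary x₀
      (by rw [hΩ.isOpen.frontier_eq]; exact ⟨hx₀, hmem⟩)
    obtain ⟨v, hv⟩ : ∃ v, fderiv ℝ ρ x₀ v < 0 := by
      by_contra! hcon
      refine hd (ContinuousLinearMap.ext fun v => le_antisymm ?_ (hcon v))
      have := hcon (-v)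
      rw [map_neg] at this
      simpa using this
    -- rescaling the direction of descent to norm at most one half
    wlog hv1 : ‖v‖ ≤ 1 / 2 generalizing v
    · refine this ((1 / (2 * ‖v‖)) • v) ?_ ?_
      · rw [map_smul, smul_eq_mul]
        exact mul_neg_of_pos_of_neg (by have : 0 < ‖v‖ := by linarith
                                        positivity) hv
      · have : 0 < ‖v‖ := by linarith
        rw [norm_smul, Real.norm_of_nonneg (by positivity)]
        field_simp
        exact le_rfl
    have hcont : Continuous fun z : EuclideanSpace ℝ (Fin N) × EuclideanSpace ℝ (Fin N) =>
        fderiv ℝ ρ z.1 z.2 :=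
      ((hρ.continuous_fderiv (by simp)).comp continuous_fst).clm_apply continuous_snd
    have hev : ∀ᶠ z in 𝓝 (x₀, v), fderiv ℝ ρ z.1 z.2 < 0 :=
      hcont.continuousAt.eventually_lt continuousAt_const hv
    obtain ⟨η, hη, hball⟩ := Metric.eventually_nhds_iff_ball.1 hev
    obtain ⟨η', hη', hU'⟩ := Metric.mem_nhds_iff.1 hU
    set m := min η η' with hm
    have hm0 : 0 < m := lt_min hη hη'
    set κ := min (1 / 2) η with hκ
    have hκ0 : 0 < κ := lt_min (by norm_num) hη
    have hκ1 : κ ≤ 1 / 2 := min_le_left _ _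
    refine ⟨Metric.ball x₀ (m / 2), Metric.ball_mem_nhds _ (half_pos hm0), κ, hκ0, m / 2,
      half_pos hm0, fun x hx r hr hr' => ⟨x + r • v, fun y hy => ?_⟩⟩
    -- a point `y` of the ball is `x + r • e` with `e` close to `v`
    obtain ⟨e, rfl⟩ : ∃ e, y = x + r • e :=
      ⟨r⁻¹ • (y - x), by rw [smul_smul, mul_inv_cancel₀ hr.ne', one_smul]; abel⟩
    have he : dist e v < κ := by
      rw [Metric.mem_ball, dist_add_left, dist_smul₀, Real.norm_of_nonneg hr.le, mul_comm] at hy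
      exact lt_of_mul_lt_mul_right hy hr.le
    have he1 : ‖e‖ < 1 := by
      have : ‖e‖ ≤ dist e v + ‖v‖ := by
        rw [dist_eq_norm]; simpa using norm_add_le (e - v) v
      linarith
    have hdist : ∀ t ∈ Icc (0 : ℝ) r, dist (x + t • e) x < r ∨ t = 0 := by
      intro t ht
      rcases ht.1.eq_or_lt with h | h
      · exact Or.inr h.symm
      · left
        rw [dist_eq_norm, add_sub_cancel_left, norm_smul, Real.norm_of_nonneg ht.1]
        calc t * ‖e‖ < t * 1 := by gcongr
          _ ≤ r := by linarith [ht.2]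
    have hnear : ∀ t ∈ Icc (0 : ℝ) r, dist (x + t • e) x₀ < m := by
      intro t ht
      have h1 : dist x x₀ < m / 2 := hx.1
      rcases hdist t ht with h | h
      · linarith [dist_triangle (x + t • e) x x₀]
      · rw [h, zero_smul, add_zero]; linarith
    have hanti : StrictAntiOn (fun t : ℝ => ρ (x + t • e)) (Icc 0 r) := by
      refine strictAntiOn_of_deriv_neg (convex_Icc _ _) ?_ fun t ht => ?_
      · exact (hρ.continuous.comp (by fun_prop)).continuousOn
      · have h1 : HasDerivAt (fun t : ℝ => x + t • e) e t := by
          simpa using ((hasDerivAt_id t).smul_const e).const_add x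
        have h2 := ((hρ.differentiable (by simp)) (x + t • e)).hasFDerivAt.comp_hasDerivAt t h1
        rw [show (fun t : ℝ => ρ (x + t • e)) = ρ ∘ fun t : ℝ => x + t • e from rfl, h2.deriv]
        refine hball (x + t • e, e) ?_
        rw [Metric.mem_ball, Prod.dist_eq, max_lt_iff]
        exact ⟨(hnear t (interior_subset ht)).trans_le (min_le_left _ _),
          he.trans_le (min_le_right _ _)⟩
    have hr0 : r ∈ Icc (0 : ℝ) r := ⟨hr.le, le_rfl⟩
    have h00 : (0 : ℝ) ∈ Icc (0 : ℝ) r := ⟨le_rfl, hr.le⟩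
    have hlt := hanti h00 hr0 hr
    simp only [zero_smul, add_zero] at hlt
    have hxU : x ∈ U := hU' (by
      have := hnear 0 h00
      rw [zero_smul, add_zero] at this
      exact this.trans_le (min_le_right _ _))
    have hyU : x + r • e ∈ U := hU' ((hnear r hr0).trans_le (min_le_right _ _))
    refine ⟨?_, (hiff _ hyU).2 (hlt.trans ((hiff _ hxU).1 hx.2))⟩
    rcases hdist r hr0 with h | h
    · exact h
    · exact absurd h hr.ne'

/-- A smooth bounded domain satisfies the measure density condition at small scales. -/
lemma IsSmoothBoundedDomain.exists_measure_density {N : ℕ} {Ω : Set (EuclideanSpace ℝ (Fin N))}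
    (hΩ : IsSmoothBoundedDomain Ω) :
    ∃ c > 0, ∃ r₀ > 0, ∀ x ∈ Ω, ∀ r, 0 < r → r ≤ r₀ →
      ENNReal.ofReal (c * r ^ N) ≤ volume (Metric.ball x r ∩ Ω) := by
  have key : ∃ κ > 0, ∃ r₀ > 0, ∀ x ∈ closure Ω ∩ Ω, ∀ r, 0 < r → r ≤ r₀ →
      ∃ z, Metric.ball z (κ * r) ⊆ Metric.ball x r ∩ Ω := by
    refine hΩ.isBounded.isCompact_closure.induction_on
      (p := fun S => ∃ κ > 0, ∃ r₀ > 0, ∀ x ∈ S ∩ Ω, ∀ r, 0 < r → r ≤ r₀ →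
        ∃ z, Metric.ball z (κ * r) ⊆ Metric.ball x r ∩ Ω) ?_ ?_ ?_ ?_
    · exact ⟨1, one_pos, 1, one_pos, fun x hx => absurd hx.1 (notMem_empty x)⟩
    · rintro S T hST ⟨κ, hκ, r₀, hr₀, h⟩
      exact ⟨κ, hκ, r₀, hr₀, fun x hx => h x ⟨hST hx.1, hx.2⟩⟩
    · rintro S T ⟨κ, hκ, r₀, hr₀, h⟩ ⟨κ', hκ', r₀', hr₀', h'⟩
      refine ⟨min κ κ', lt_min hκ hκ', min r₀ r₀', lt_min hr₀ hr₀', fun x hx r hr hrr => ?_⟩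
      rcases hx.1 with hS | hT
      · obtain ⟨z, hz⟩ := h x ⟨hS, hx.2⟩ r hr (hrr.trans (min_le_left _ _))
        exact ⟨z, (Metric.ball_subset_ball (by gcongr; exact min_le_left _ _)).trans hz⟩
      · obtain ⟨z, hz⟩ := h' x ⟨hT, hx.2⟩ r hr (hrr.trans (min_le_right _ _))
        exact ⟨z, (Metric.ball_subset_ball (by gcongr; exact min_le_right _ _)).trans hz⟩
    · intro x hx
      obtain ⟨V, hV, h⟩ := hΩ.exists_ball_subset_nhds hx
      exact ⟨V, mem_nhdsWithin_of_mem_nhds hV, h⟩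
  obtain ⟨κ, hκ, r₀, hr₀, h⟩ := key
  have hb : volume (Metric.ball (0 : EuclideanSpace ℝ (Fin N)) 1) ≠ ⊤ :=
    measure_ball_lt_top.ne
  have hb0 : volume (Metric.ball (0 : EuclideanSpace ℝ (Fin N)) 1) ≠ 0 :=
    (Metric.measure_ball_pos _ _ one_pos).ne'
  refine ⟨κ ^ N * (volume (Metric.ball (0 : EuclideanSpace ℝ (Fin N)) 1)).toReal,
    mul_pos (pow_pos hκ _) (ENNReal.toReal_pos hb0 hb), r₀, hr₀, fun x hx r hr hrr => ?_⟩
  obtain ⟨z, hz⟩ := h x ⟨subset_closure hx, hx⟩ r hr hrr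
  refine le_trans (le_of_eq ?_) (measure_mono hz)
  rw [Measure.addHaar_ball_of_pos _ _ (mul_pos hκ hr), finrank_euclideanSpace_fin,
    show κ ^ N * (volume (Metric.ball (0 : EuclideanSpace ℝ (Fin N)) 1)).toReal * r ^ N =
      (κ * r) ^ N * (volume (Metric.ball (0 : EuclideanSpace ℝ (Fin N)) 1)).toReal by ring,
    ENNReal.ofReal_mul (by positivity), ENNReal.ofReal_toReal hb]

/-! ### Smooth truncations -/

/-- A smooth odd substitute for `t ↦ sign t * max (|t| - k) 0`: it vanishes on `[-k, k]`, its slope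
lies in `[0, 1]`, and the slope equals one as soon as `|t| ≥ k + τ` (for `k ≥ 1`). -/
def truncation (k τ t : ℝ) : ℝ :=
  ∫ x in (0 : ℝ)..t, Real.smoothTransition ((x ^ 2 - k ^ 2) / τ)

lemma continuous_truncation_slope (k τ : ℝ) :
    Continuous fun x : ℝ => Real.smoothTransition ((x ^ 2 - k ^ 2) / τ) :=
  Real.smoothTransition.continuous.comp (by fun_prop)

lemma hasDerivAt_truncation (k τ t : ℝ) :
    HasDerivAt (truncation k τ) (Real.smoothTransition ((t ^ 2 - k ^ 2) / τ)) t :=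
  intervalIntegral.integral_hasDerivAt_right
    ((continuous_truncation_slope k τ).intervalIntegrable _ _)
    ((continuous_truncation_slope k τ).stronglyMeasurableAtFilter _ _)
    (continuous_truncation_slope k τ).continuousAt

lemma contDiff_truncation (k τ : ℝ) : ContDiff ℝ ∞ (truncation k τ) := by
  refine contDiff_infty_iff_deriv.2
    ⟨fun t => (hasDerivAt_truncation k τ t).differentiableAt, ?_⟩
  rw [show deriv (truncation k τ) = fun t => Real.smoothTransition ((t ^ 2 - k ^ 2) / τ) from
    funext fun t => (hasDerivAt_truncation k τ t).deriv]
  exact Real.smoothTransition.contDiff.comp (by fun_prop)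

lemma monotone_truncation (k τ : ℝ) : Monotone (truncation k τ) :=
  monotone_of_deriv_nonneg (fun t => (hasDerivAt_truncation k τ t).differentiableAt) fun t => by
    rw [(hasDerivAt_truncation k τ t).deriv]
    exact Real.smoothTransition.nonneg _

lemma abs_truncation_sub_le (k τ a b : ℝ) :
    |truncation k τ a - truncation k τ b| ≤ |a - b| := by
  have := Convex.norm_image_sub_le_of_norm_deriv_le (f := truncation k τ) (C := 1) (s := univ)
    (x := b) (y := a) (fun t _ => (hasDerivAt_truncation k τ t).differentiableAt)
    (fun t _ => by
      rw [(hasDerivAt_truncation k τ t).deriv, Real.norm_of_nonneg (Real.smoothTransition.nonneg _)]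
      exact Real.smoothTransition.le_one _) convex_univ (mem_univ _) (mem_univ _)
  simpa using this

lemma truncation_neg (k τ t : ℝ) : truncation k τ (-t) = -truncation k τ t := by
  have := intervalIntegral.integral_comp_neg (a := 0) (b := t)
    (fun x : ℝ => Real.smoothTransition ((x ^ 2 - k ^ 2) / τ))
  simp only [neg_sq, neg_zero] at this
  rw [truncation, truncation, this, intervalIntegral.integral_symm]

lemma truncation_eq_zero {k τ t : ℝ} (hτ : 0 < τ) (ht : |t| ≤ k) : truncation k τ t = 0 := by
  rw [truncation, intervalIntegral.integral_congr (g := fun _ => (0 : ℝ)),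
    intervalIntegral.integral_zero]
  intro x hx
  refine Real.smoothTransition.zero_of_nonpos (div_nonpos_of_nonpos_of_nonneg ?_ hτ.le)
  have hx' : |x| ≤ |t| := by
    simpa using abs_sub_left_of_mem_uIcc hx
  have := sq_le_sq' (by linarith [abs_nonneg x, hx'.trans ht]) (hx'.trans ht)
  rw [sq_abs] at this
  linarith

lemma abs_sub_le_abs_truncation {k τ : ℝ} (hk : 1 ≤ k) (hτ : 0 < τ) (t : ℝ) :
    |t| - k - τ ≤ |truncation k τ t| := by
  wlog ht : 0 ≤ t generalizing t
  · have := this (-t) (by linarith)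
    rwa [truncation_neg, abs_neg, abs_neg] at this
  rw [abs_of_nonneg ht]
  rcases le_total t (k + τ) with h | h
  · exact le_trans (by linarith) (abs_nonneg _)
  · have hi : ∀ a b, IntervalIntegrable
        (fun x : ℝ => Real.smoothTransition ((x ^ 2 - k ^ 2) / τ)) volume a b := fun a b =>
      (continuous_truncation_slope k τ).intervalIntegrable _ _
    have h1 : ∫ x in (k + τ)..t, Real.smoothTransition ((x ^ 2 - k ^ 2) / τ) = t - k - τ := by
      rw [intervalIntegral.integral_congr (g := fun _ => (1 : ℝ))]
      · simp; ring
      · intro x hx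
        rw [uIcc_of_le h] at hx
        refine Real.smoothTransition.one_of_one_le ((one_le_div hτ).2 ?_)
        nlinarith [hx.1]
    have h2 : 0 ≤ truncation k τ (k + τ) := by
      have := monotone_truncation k τ (show (0 : ℝ) ≤ k + τ by linarith)
      rwa [truncation_eq_zero hτ (t := 0) (by rw [abs_zero]; linarith)] at this
    have h3 : truncation k τ t = truncation k τ (k + τ) + (t - k - τ) := by
      rw [← h1, truncation, truncation, intervalIntegral.integral_add_adjacent_intervals
        (hi _ _) (hi _ _)]
    rw [h3]
    exact le_trans (by linarith) (le_abs_self _)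

/-! ### Modulars and norms -/

section Modular

variable {N : ℕ} {Ω : Set (EuclideanSpace ℝ (Fin N))} {s P : ℝ}
  {p : EuclideanSpace ℝ (Fin N) → EuclideanSpace ℝ (Fin N) → ℝ}
  {q u v w : EuclideanSpace ℝ (Fin N) → ℝ}

lemma volume_restrict_prod (Ω : Set (EuclideanSpace ℝ (Fin N))) :
    (volume.restrict (Ω ×ˢ Ω) : Measure (EuclideanSpace ℝ (Fin N) × EuclideanSpace ℝ (Fin N))) =
      (volume.restrict Ω).prod (volume.restrict Ω) := by
  rw [Measure.volume_eq_prod, Measure.prod_restrict]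

lemma ae_fst_and_snd {Q : EuclideanSpace ℝ (Fin N) → Prop} (h : ∀ᵐ x ∂(volume.restrict Ω), Q x) :
    ∀ᵐ z ∂(volume.restrict (Ω ×ˢ Ω)), Q z.1 ∧ Q z.2 := by
  rw [volume_restrict_prod]
  exact (Measure.quasiMeasurePreserving_fst.ae h).and (Measure.quasiMeasurePreserving_snd.ae h)

lemma aemeasurable_exponent (hΩ : MeasurableSet Ω)
    (hp : ContinuousOn (Function.uncurry p) (closure Ω ×ˢ closure Ω)) :
    AEMeasurable (fun z : EuclideanSpace ℝ (Fin N) × EuclideanSpace ℝ (Fin N) => p z.1 z.2)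
      (volume.restrict (Ω ×ˢ Ω)) :=
  (hp.mono (prod_mono subset_closure subset_closure)).aemeasurable (hΩ.prod hΩ)

lemma aemeasurable_increment (hu : AEMeasurable u (volume.restrict Ω)) :
    AEMeasurable (fun z : EuclideanSpace ℝ (Fin N) × EuclideanSpace ℝ (Fin N) => u z.1 - u z.2)
      (volume.restrict (Ω ×ˢ Ω)) := by
  rw [volume_restrict_prod]
  exact (hu.comp_quasiMeasurePreserving Measure.quasiMeasurePreserving_fst).sub
    (hu.comp_quasiMeasurePreserving Measure.quasiMeasurePreserving_snd)

lemma aemeasurable_gagliardo_integrand (hΩ : MeasurableSet Ω)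
    (hp : ContinuousOn (Function.uncurry p) (closure Ω ×ˢ closure Ω))
    (hu : AEMeasurable u (volume.restrict Ω)) (μ : ℝ) :
    AEMeasurable (fun z : EuclideanSpace ℝ (Fin N) × EuclideanSpace ℝ (Fin N) =>
      |u z.1 - u z.2| ^ p z.1 z.2 / (μ ^ p z.1 z.2 * ‖z.1 - z.2‖ ^ ((N : ℝ) + s * p z.1 z.2)))
      (volume.restrict (Ω ×ˢ Ω)) := by
  have h1 := aemeasurable_exponent hΩ hp
  have h2 := aemeasurable_increment hu
  have h3 : AEMeasurable (fun z : EuclideanSpace ℝ (Fin N) × EuclideanSpace ℝ (Fin N) =>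
      ‖z.1 - z.2‖) (volume.restrict (Ω ×ˢ Ω)) :=
    (continuous_fst.sub continuous_snd).norm.aemeasurable
  exact ((continuous_abs.measurable.comp_aemeasurable h2).pow h1).div
    ((aemeasurable_const.pow h1).mul (h3.pow ((h1.const_mul s).const_add _)))

lemma gagliardo_mono (hΩ : MeasurableSet Ω) {μ : ℝ} (hμ : 0 < μ)
    (hp : ∀ x ∈ Ω, ∀ y ∈ Ω, 1 ≤ p x y ∧ p x y ≤ P)
    (h : ∀ x ∈ Ω, ∀ y ∈ Ω, |w x - w y| ≤ |u x - u y|) :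
    gagliardo Ω s p w μ ≤ gagliardo Ω s p u μ := by
  refine setLIntegral_mono' (hΩ.prod hΩ) fun z hz => ENNReal.ofReal_le_ofReal ?_
  have := hp _ hz.1 _ hz.2
  have := h _ hz.1 _ hz.2
  gcongr
  linarith

lemma gagliardo_le_mul (hΩ : MeasurableSet Ω) {a b C : ℝ} (ha : 0 < a) (hb : 0 < b) (hC : 0 ≤ C)
    (h : ∀ x ∈ Ω, ∀ y ∈ Ω, (b / a) ^ p x y ≤ C) :
    gagliardo Ω s p u a ≤ ENNReal.ofReal C * gagliardo Ω s p u b := by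
  rw [gagliardo, gagliardo, ← lintegral_const_mul' _ _ ENNReal.ofReal_ne_top]
  refine setLIntegral_mono' (hΩ.prod hΩ) fun z hz => ?_
  rw [← ENNReal.ofReal_mul hC]
  refine ENNReal.ofReal_le_ofReal ?_
  have h1 := h _ hz.1 _ hz.2
  have ha' := Real.rpow_pos_of_pos ha (p z.1 z.2)
  have hb' := Real.rpow_pos_of_pos hb (p z.1 z.2)
  rw [Real.div_rpow hb.le ha.le, div_le_iff₀ ha'] at h1
  have h0 : 0 ≤ |u z.1 - u z.2| ^ p z.1 z.2 / ‖z.1 - z.2‖ ^ ((N : ℝ) + s * p z.1 z.2) := by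
    positivity
  calc |u z.1 - u z.2| ^ p z.1 z.2 / (a ^ p z.1 z.2 * ‖z.1 - z.2‖ ^ ((N : ℝ) + s * p z.1 z.2))
      = (a ^ p z.1 z.2)⁻¹ *
        (|u z.1 - u z.2| ^ p z.1 z.2 / ‖z.1 - z.2‖ ^ ((N : ℝ) + s * p z.1 z.2)) := by
        rw [mul_comm (a ^ _), ← div_div]; ring
    _ ≤ (C * (b ^ p z.1 z.2)⁻¹) *
        (|u z.1 - u z.2| ^ p z.1 z.2 / ‖z.1 - z.2‖ ^ ((N : ℝ) + s * p z.1 z.2)) := by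
        refine mul_le_mul_of_nonneg_right ?_ h0
        rw [← div_eq_mul_inv, le_div_iff₀ hb', inv_mul_le_iff₀ ha']
        linarith
    _ = _ := by rw [mul_comm (b ^ _) (‖z.1 - z.2‖ ^ _), ← div_div]; ring

lemma gagliardo_le_rpow_mul (hΩ : MeasurableSet Ω) {a b : ℝ} (ha : 0 < a) (hb : 0 < b)
    (hp : ∀ x ∈ Ω, ∀ y ∈ Ω, 1 ≤ p x y ∧ p x y ≤ P) :
    gagliardo Ω s p u a ≤ ENNReal.ofReal (max 1 (b / a) ^ P) * gagliardo Ω s p u b := by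
  refine gagliardo_le_mul hΩ ha hb (by positivity) fun x hx y hy => ?_
  have h1 := hp x hx y hy
  calc (b / a) ^ p x y ≤ max 1 (b / a) ^ p x y := by
        gcongr
        · linarith
        · exact le_max_right _ _
    _ ≤ max 1 (b / a) ^ P := Real.rpow_le_rpow_of_exponent_le (le_max_left _ _) h1.2

lemma MemW.gagliardo_one_lt_top (hΩ : MeasurableSet Ω)
    (hp : ∀ x ∈ Ω, ∀ y ∈ Ω, 1 ≤ p x y ∧ p x y ≤ P) (hu : MemW Ω s q p u) :
    gagliardo Ω s p u 1 < ⊤ := by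
  obtain ⟨μ, hμ, h⟩ := hu.2
  exact (gagliardo_le_rpow_mul hΩ one_pos hμ hp).trans_lt
    (ENNReal.mul_lt_top ENNReal.ofReal_lt_top h)

lemma gagliardo_one_le_of_seminorm_lt (hΩ : MeasurableSet Ω)
    (hp : ∀ x ∈ Ω, ∀ y ∈ Ω, 1 ≤ p x y ∧ p x y ≤ P) {ε : ℝ} (hε : ε ≤ 1)
    (h : seminorm Ω s p v < ENNReal.ofReal ε) : gagliardo Ω s p v 1 ≤ ENNReal.ofReal ε := by
  simp only [seminorm, iInf_lt_iff] at h
  obtain ⟨μ, ⟨hμ, h1⟩, h2⟩ := h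
  have hμε : μ < ε := (ENNReal.ofReal_lt_ofReal_iff_of_nonneg hμ.le).1 h2
  refine (gagliardo_le_mul hΩ one_pos hμ (hμ.le.trans hμε.le) fun x hx y hy => ?_).trans
    (mul_le_of_le_one_right' h1.le)
  rw [div_one]
  calc μ ^ p x y ≤ μ ^ (1 : ℝ) :=
        Real.rpow_le_rpow_of_exponent_ge hμ (hμε.le.trans hε) (hp x hx y hy).1
    _ ≤ ε := by rw [Real.rpow_one]; exact hμε.le

lemma modular_le_of_luxNorm_lt (hΩ : MeasurableSet Ω) (hq : ∀ x ∈ Ω, 1 ≤ q x) {ε : ℝ} (hε : ε ≤ 1)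
    (h : luxNorm Ω q v < ENNReal.ofReal ε) :
    ∫⁻ x in Ω, ENNReal.ofReal (|v x| ^ q x) ≤ ENNReal.ofReal ε := by
  simp only [luxNorm, iInf_lt_iff] at h
  obtain ⟨μ, ⟨hμ, h1⟩, h2⟩ := h
  have hμε : μ < ε := (ENNReal.ofReal_lt_ofReal_iff_of_nonneg hμ.le).1 h2
  calc ∫⁻ x in Ω, ENNReal.ofReal (|v x| ^ q x)
      ≤ ∫⁻ x in Ω, ENNReal.ofReal ε * ENNReal.ofReal (|v x / μ| ^ q x) := by
        refine setLIntegral_mono' hΩ fun x hx => ?_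
        rw [← ENNReal.ofReal_mul (hμ.le.trans hμε.le)]
        refine ENNReal.ofReal_le_ofReal ?_
        rw [abs_div, abs_of_pos hμ, Real.div_rpow (abs_nonneg _) hμ.le]
        have h3 : μ ^ q x ≤ ε := by
          calc μ ^ q x ≤ μ ^ (1 : ℝ) :=
              Real.rpow_le_rpow_of_exponent_ge hμ (hμε.le.trans hε) (hq x hx)
            _ ≤ ε := by rw [Real.rpow_one]; exact hμε.le
        have h4 := Real.rpow_pos_of_pos hμ (q x)
        rw [← mul_div_assoc, le_div_iff₀ h4, mul_comm]
        gcongr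
    _ = ENNReal.ofReal ε * ∫⁻ x in Ω, ENNReal.ofReal (|v x / μ| ^ q x) :=
        lintegral_const_mul' _ _ ENNReal.ofReal_ne_top
    _ ≤ ENNReal.ofReal ε := mul_le_of_le_one_right' h1

lemma luxNorm_mono (hΩ : MeasurableSet Ω) (hq : ∀ x ∈ Ω, 1 ≤ q x) (h : ∀ x, |w x| ≤ |v x|) :
    luxNorm Ω q w ≤ luxNorm Ω q v := by
  refine iInf_mono fun μ => iInf_mono' fun hμ => ⟨⟨hμ.1, le_trans ?_ hμ.2⟩, le_rfl⟩
  refine setLIntegral_mono' hΩ fun x hx => ENNReal.ofReal_le_ofReal ?_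
  have := hq x hx
  have := h x
  rw [abs_div, abs_div]
  gcongr

lemma MemLq.lintegral_abs_lt_top (hΩ : MeasurableSet Ω) (hΩ' : volume Ω ≠ ⊤)
    (hq : ∀ x ∈ Ω, 1 ≤ q x) (hu : MemLq Ω q u) : ∫⁻ x in Ω, ENNReal.ofReal |u x| < ⊤ := by
  calc ∫⁻ x in Ω, ENNReal.ofReal |u x|
      ≤ ∫⁻ x in Ω, (1 + ENNReal.ofReal (|u x| ^ q x)) := by
        refine setLIntegral_mono' hΩ fun x hx => ?_
        rw [← ENNReal.ofReal_one, ← ENNReal.ofReal_add zero_le_one (by positivity)]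
        refine ENNReal.ofReal_le_ofReal ?_
        rcases le_total |u x| 1 with h | h
        · linarith [Real.rpow_nonneg (abs_nonneg (u x)) (q x)]
        · linarith [Real.self_le_rpow_of_one_le h (hq x hx)]
    _ = volume Ω + ∫⁻ x in Ω, ENNReal.ofReal (|u x| ^ q x) := by
        rw [lintegral_add_left measurable_const]; simp
    _ < ⊤ := ENNReal.add_lt_top.2 ⟨hΩ'.lt_top, hu.2⟩

/-! ### Stability of the closure of test functions under smooth truncation -/

lemma IsTestFunction.comp_left {φ : EuclideanSpace ℝ (Fin N) → ℝ} (hφ : IsTestFunction Ω φ)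
    {H : ℝ → ℝ} (hH : ContDiff ℝ ∞ H) (hH0 : H 0 = 0) : IsTestFunction Ω (H ∘ φ) :=
  ⟨hH.comp hφ.1, hφ.2.1.comp_left hH0,
    (closure_mono (Function.support_comp_subset hH0 φ)).trans hφ.2.2⟩

lemma add_rpow_le_two_rpow_mul {a b r : ℝ} (ha : 0 ≤ a) (hb : 0 ≤ b) (hr : 1 ≤ r) (hrP : r ≤ P) :
    (2 * a + b) ^ r ≤ 4 ^ P * a ^ r + 2 ^ P * b ^ r := by
  have h1 : (2 * a + b) ^ r ≤ (2 * max (2 * a) b) ^ r := by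
    gcongr
    linarith [le_max_left (2 * a) b, le_max_right (2 * a) b]
  have h2 : (max (2 * a) b) ^ r ≤ (2 * a) ^ r + b ^ r := by
    rcases max_cases (2 * a) b with h | h <;> rw [h.1]
    · linarith [Real.rpow_nonneg hb r]
    · linarith [Real.rpow_nonneg (mul_nonneg zero_le_two ha) r]
  have h4 : (4 : ℝ) ^ r ≤ 4 ^ P := Real.rpow_le_rpow_of_exponent_le (by norm_num) hrP
  have h5 : (2 : ℝ) ^ r ≤ 2 ^ P := Real.rpow_le_rpow_of_exponent_le (by norm_num) hrP
  have h6 : (2 : ℝ) ^ r * 2 ^ r = 4 ^ r := by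
    rw [← Real.mul_rpow zero_le_two zero_le_two]; norm_num
  rw [Real.mul_rpow zero_le_two (le_max_of_le_right hb)] at h1
  rw [Real.mul_rpow zero_le_two ha] at h2
  calc (2 * a + b) ^ r ≤ 2 ^ r * (2 ^ r * a ^ r + b ^ r) := h1.trans (by gcongr)
    _ = 4 ^ r * a ^ r + 2 ^ r * b ^ r := by rw [← h6]; ring
    _ ≤ _ := by gcongr

/-- If `u - φ n` tends to zero in modular and almost everywhere, so does the Gagliardo modular of
`H ∘ u - H ∘ φ n`. The integrands are dominated, up to an error that tends to zero in `L¹`, by a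
multiple of the integrand of `u`. -/
lemma tendsto_gagliardo_comp_sub (hΩ : MeasurableSet Ω)
    (hpc : ContinuousOn (Function.uncurry p) (closure Ω ×ˢ closure Ω))
    (hp : ∀ x ∈ Ω, ∀ y ∈ Ω, 1 ≤ p x y ∧ p x y ≤ P)
    (hu : AEMeasurable u (volume.restrict Ω)) (hfin : gagliardo Ω s p u 1 < ⊤)
    {φ : ℕ → EuclideanSpace ℝ (Fin N) → ℝ} (hφ : ∀ n, AEMeasurable (φ n) (volume.restrict Ω))
    (hlim : Filter.Tendsto (fun n => gagliardo Ω s p (fun x => u x - φ n x) 1) Filter.atTop (𝓝 0))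
    (hae : ∀ᵐ x ∂(volume.restrict Ω), Filter.Tendsto (fun n => φ n x) Filter.atTop (𝓝 (u x)))
    {H : ℝ → ℝ} (hH : ∀ a b, |H a - H b| ≤ |a - b|) :
    Filter.Tendsto (fun n => gagliardo Ω s p (fun x => H (u x) - H (φ n x)) 1)
      Filter.atTop (𝓝 0) := by
  have hHc : Continuous H := (LipschitzWith.of_dist_le_mul (K := 1) fun a b => by
    simpa [Real.dist_eq] using hH a b).continuous
  let F : (EuclideanSpace ℝ (Fin N) → ℝ) → EuclideanSpace ℝ (Fin N) × EuclideanSpace ℝ (Fin N) →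
    ℝ≥0∞ := fun v z => ENNReal.ofReal
      (|v z.1 - v z.2| ^ p z.1 z.2 / (1 ^ p z.1 z.2 * ‖z.1 - z.2‖ ^ ((N : ℝ) + s * p z.1 z.2)))
  have hF : ∀ v, gagliardo Ω s p v 1 = ∫⁻ z in Ω ×ˢ Ω, F v z := fun v => rfl
  have hFm : ∀ v, AEMeasurable v (volume.restrict Ω) →
      AEMeasurable (F v) (volume.restrict (Ω ×ˢ Ω)) := fun v hv =>
    (aemeasurable_gagliardo_integrand hΩ hpc hv 1).ennreal_ofReal
  let g : ℕ → EuclideanSpace ℝ (Fin N) → ℝ := fun n x => H (u x) - H (φ n x)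
  have hg : ∀ n, AEMeasurable (g n) (volume.restrict Ω) := fun n =>
    (hHc.measurable.comp_aemeasurable hu).sub (hHc.measurable.comp_aemeasurable (hφ n))
  have hv : ∀ n, AEMeasurable (fun x => u x - φ n x) (volume.restrict Ω) := fun n => hu.sub (hφ n)
  let U := fun z => ENNReal.ofReal (4 ^ P) * F u z
  have hUm : AEMeasurable U (volume.restrict (Ω ×ˢ Ω)) := (hFm u hu).const_mul _
  have hUfin : ∫⁻ z in Ω ×ˢ Ω, U z ≠ ⊤ := by
    rw [lintegral_const_mul' _ _ ENNReal.ofReal_ne_top]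
    exact (ENNReal.mul_lt_top ENNReal.ofReal_lt_top hfin).ne
  have hbound : ∀ n, ∀ z ∈ Ω ×ˢ Ω, F (g n) z ≤
      U z + ENNReal.ofReal (2 ^ P) * F (fun x => u x - φ n x) z := by
    intro n z hz
    have hpz := hp _ hz.1 _ hz.2
    simp only [U, F]
    rw [← ENNReal.ofReal_mul (by positivity), ← ENNReal.ofReal_mul (by positivity),
      ← ENNReal.ofReal_add (by positivity) (by positivity), ← mul_div_assoc, ← mul_div_assoc,
      ← add_div]
    refine ENNReal.ofReal_le_ofReal (div_le_div_of_nonneg_right ?_ (by positivity))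
    refine le_trans (Real.rpow_le_rpow (abs_nonneg _) ?_ (by linarith))
      (add_rpow_le_two_rpow_mul (abs_nonneg _) (abs_nonneg _) hpz.1 hpz.2)
    calc |g n z.1 - g n z.2|
        = |(H (u z.1) - H (u z.2)) - (H (φ n z.1) - H (φ n z.2))| := by
          simp only [g]; congr 1; ring
      _ ≤ |H (u z.1) - H (u z.2)| + |H (φ n z.1) - H (φ n z.2)| := abs_sub _ _
      _ ≤ |u z.1 - u z.2| + |φ n z.1 - φ n z.2| := add_le_add (hH _ _) (hH _ _)
      _ = |u z.1 - u z.2| + |(u z.1 - u z.2) - (u z.1 - φ n z.1 - (u z.2 - φ n z.2))| := by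
          congr 2; ring
      _ ≤ |u z.1 - u z.2| + (|u z.1 - u z.2| + |u z.1 - φ n z.1 - (u z.2 - φ n z.2)|) := by
          gcongr; exact abs_sub _ _
      _ = _ := by ring
  have hmin : Filter.Tendsto (fun n => ∫⁻ z in Ω ×ˢ Ω, min (F (g n) z) (U z)) Filter.atTop
      (𝓝 0) := by
    have := tendsto_lintegral_of_dominated_convergence' (μ := volume.restrict (Ω ×ˢ Ω))
      (F := fun n z => min (F (g n) z) (U z)) (f := fun _ => 0) U
      (fun n => (hFm _ (hg n)).min hUm) (fun n => Filter.Eventually.of_forall fun z =>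
        min_le_right _ _) hUfin ?_
    · simpa using this
    · filter_upwards [ae_fst_and_snd hae, ae_restrict_mem (hΩ.prod hΩ)] with z hz hzΩ
      have hpz := hp _ hzΩ.1 _ hzΩ.2
      refine tendsto_of_tendsto_of_tendsto_of_le_of_le tendsto_const_nhds (h := fun n => F (g n) z)
        ?_ (fun n => zero_le) (fun n => min_le_left _ _)
      have h1 : Filter.Tendsto (fun n => g n z.1 - g n z.2) Filter.atTop (𝓝 0) := by
        have := (((hHc.tendsto _).comp hz.1).const_sub (H (u z.1))).sub
          (((hHc.tendsto _).comp hz.2).const_sub (H (u z.2)))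
        simpa [g] using this
      have h2 := (h1.abs.rpow_const (p := p z.1 z.2) (Or.inr (by linarith))).div_const
        (1 ^ p z.1 z.2 * ‖z.1 - z.2‖ ^ ((N : ℝ) + s * p z.1 z.2))
      rw [abs_zero, Real.zero_rpow (by linarith), zero_div] at h2
      simpa [F] using ENNReal.tendsto_ofReal h2
  have hsum : Filter.Tendsto (fun n => (∫⁻ z in Ω ×ˢ Ω, min (F (g n) z) (U z)) +
      ENNReal.ofReal (2 ^ P) * gagliardo Ω s p (fun x => u x - φ n x) 1) Filter.atTop (𝓝 0) := by
    simpa using hmin.add (ENNReal.Tendsto.const_mul hlim (Or.inr ENNReal.ofReal_ne_top))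
  refine tendsto_of_tendsto_of_tendsto_of_le_of_le tendsto_const_nhds hsum
    (fun n => zero_le) fun n => ?_
  rw [hF, hF, ← lintegral_const_mul' _ _ ENNReal.ofReal_ne_top,
    ← lintegral_add_right' _ ((hFm _ (hv n)).const_mul _)]
  refine setLIntegral_mono' (hΩ.prod hΩ) fun z hz => ?_
  rcases le_total (F (g n) z) (U z) with h | h
  · rw [min_eq_left h]; exact le_self_add
  · rw [min_eq_right h]; exact hbound n z hz

lemma ae_tendsto_of_modular_le {φ : ℕ → EuclideanSpace ℝ (Fin N) → ℝ} (hΩ : MeasurableSet Ω)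
    (hqc : ContinuousOn q Ω) (hq : ∀ x ∈ Ω, 1 ≤ q x) (hu : AEMeasurable u (volume.restrict Ω))
    (hφ : ∀ n, AEMeasurable (φ n) (volume.restrict Ω))
    (h : ∀ n, ∫⁻ x in Ω, ENNReal.ofReal (|u x - φ n x| ^ q x) ≤ ENNReal.ofReal ((1 / 2) ^ n)) :
    ∀ᵐ x ∂(volume.restrict Ω), Filter.Tendsto (fun n => φ n x) Filter.atTop (𝓝 (u x)) := by
  have hm : ∀ n, AEMeasurable (fun x => ENNReal.ofReal (|u x - φ n x| ^ q x))
      (volume.restrict Ω) := fun n =>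
    ((continuous_abs.measurable.comp_aemeasurable (hu.sub (hφ n))).pow
      (hqc.aemeasurable hΩ)).ennreal_ofReal
  have hsum : ∫⁻ x in Ω, ∑' n, ENNReal.ofReal (|u x - φ n x| ^ q x) ≠ ⊤ := by
    rw [lintegral_tsum hm]
    refine ne_top_of_le_ne_top ?_ (ENNReal.tsum_le_tsum h)
    rw [← ENNReal.ofReal_tsum_of_nonneg (fun n => by positivity) summable_geometric_two]
    exact ENNReal.ofReal_ne_top
  filter_upwards [ae_lt_top' (AEMeasurable.tsum hm) hsum, ae_restrict_mem hΩ] with x hx hxΩ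
  have hqx := hq x hxΩ
  have h1 := ENNReal.tendsto_atTop_zero_of_tsum_ne_top hx.ne
  have h2 := (ENNReal.tendsto_toReal ENNReal.zero_ne_top).comp h1
  have h3 : Filter.Tendsto (fun n => |u x - φ n x| ^ q x) Filter.atTop (𝓝 0) := by
    refine (Filter.tendsto_congr fun n => ?_).1 h2
    exact ENNReal.toReal_ofReal (by positivity)
  have h4 := h3.rpow_const (p := (q x)⁻¹) (Or.inr (by positivity))
  rw [Real.zero_rpow (by positivity)] at h4
  have h5 : Filter.Tendsto (fun n => |u x - φ n x|) Filter.atTop (𝓝 0) := by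
    refine (Filter.tendsto_congr fun n => ?_).1 h4
    exact Real.rpow_rpow_inv (abs_nonneg _) (by positivity)
  have h6 := ((tendsto_zero_iff_abs_tendsto_zero _).2 h5).const_sub (u x)
  simpa using h6

/-- The closure of the test functions is stable under composition with a smooth `1`-Lipschitz
function vanishing at the origin. -/
lemma MemW₀.comp_left (hΩ : MeasurableSet Ω)
    (hpc : ContinuousOn (Function.uncurry p) (closure Ω ×ˢ closure Ω))
    (hp : ∀ x ∈ Ω, ∀ y ∈ Ω, 1 ≤ p x y ∧ p x y ≤ P)
    (hqc : ContinuousOn q Ω) (hq : ∀ x ∈ Ω, 1 ≤ q x) (hu : MemW₀ Ω s q p u)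
    {H : ℝ → ℝ} (hH : ContDiff ℝ ∞ H) (hH0 : H 0 = 0) (hHL : ∀ a b, |H a - H b| ≤ |a - b|) :
    MemW₀ Ω s q p (H ∘ u) := by
  have hum : AEMeasurable u (volume.restrict Ω) := hu.1.1.1.aemeasurable
  have habs : ∀ t, |H t| ≤ |t| := fun t => by simpa [hH0] using hHL t 0
  refine ⟨⟨⟨hH.continuous.comp_aestronglyMeasurable hu.1.1.1, ?_⟩, ?_⟩, fun ε hε => ?_⟩
  · refine lt_of_le_of_lt (setLIntegral_mono' hΩ fun x hx => ENNReal.ofReal_le_ofReal ?_) hu.1.1.2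
    have := hq x hx
    exact Real.rpow_le_rpow (abs_nonneg _) (habs _) (by linarith)
  · obtain ⟨μ, hμ, h⟩ := hu.1.2
    exact ⟨μ, hμ, (gagliardo_mono hΩ hμ hp fun x _ y _ => hHL _ _).trans_lt h⟩
  · choose φ hφt hφ using fun n : ℕ => hu.2 (ENNReal.ofReal ((1 / 2) ^ n))
      (ENNReal.ofReal_pos.2 (by positivity))
    have hle1 : ∀ n : ℕ, ((1 : ℝ) / 2) ^ n ≤ 1 := fun n =>
      pow_le_one₀ (by norm_num) (by norm_num)
    have hφm : ∀ n, AEMeasurable (φ n) (volume.restrict Ω) := fun n =>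
      (hφt n).1.continuous.aemeasurable
    have hlux : ∀ n, luxNorm Ω q (fun x => u x - φ n x) < ENNReal.ofReal ((1 / 2) ^ n) := fun n =>
      lt_of_le_of_lt le_self_add (hφ n)
    have hsem : ∀ n, seminorm Ω s p (fun x => u x - φ n x) < ENNReal.ofReal ((1 / 2) ^ n) :=
      fun n => lt_of_le_of_lt le_add_self (hφ n)
    have hpow : Filter.Tendsto (fun n : ℕ => ENNReal.ofReal ((1 / 2) ^ n)) Filter.atTop (𝓝 0) := by
      simpa using ENNReal.tendsto_ofReal
        (tendsto_pow_atTop_nhds_zero_of_lt_one (r := (1 / 2 : ℝ)) (by norm_num) (by norm_num))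
    have hae := ae_tendsto_of_modular_le hΩ hqc hq hum hφm fun n =>
      modular_le_of_luxNorm_lt hΩ hq (hle1 n) (hlux n)
    have hg := tendsto_gagliardo_comp_sub (s := s) hΩ hpc hp hum (hu.1.gagliardo_one_lt_top hΩ hp)
      hφm (tendsto_of_tendsto_of_tendsto_of_le_of_le tendsto_const_nhds hpow (fun n => zero_le)
        fun n => gagliardo_one_le_of_seminorm_lt hΩ hp (hle1 n) (hsem n)) hae hHL
    obtain ⟨η, hη, hηε⟩ : ∃ η : ℝ, 0 < η ∧ ENNReal.ofReal η < ε / 2 := by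
      obtain ⟨η, h1, h2⟩ := ENNReal.lt_iff_exists_nnreal_btwn.1 (ENNReal.half_pos hε.ne')
      exact ⟨η, by exact_mod_cast h1, by simpa using h2⟩
    have hgη : Filter.Tendsto (fun n => ENNReal.ofReal (max 1 (1 / η) ^ P) *
        gagliardo Ω s p (fun x => H (u x) - H (φ n x)) 1) Filter.atTop (𝓝 0) := by
      simpa using ENNReal.Tendsto.const_mul hg (Or.inr ENNReal.ofReal_ne_top)
    obtain ⟨n, hn1, hn2⟩ := ((hgη.eventually (gt_mem_nhds one_pos)).and
      (hpow.eventually (gt_mem_nhds (ENNReal.half_pos hε.ne')))).exists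
    refine ⟨H ∘ φ n, (hφt n).comp_left hH hH0, ?_⟩
    calc normW Ω s q p (fun x => (H ∘ u) x - (H ∘ φ n) x)
        ≤ luxNorm Ω q (fun x => u x - φ n x) + ENNReal.ofReal η := by
          refine add_le_add (luxNorm_mono hΩ hq fun x => hHL _ _) ?_
          exact iInf₂_le η ⟨hη, (gagliardo_le_rpow_mul hΩ hη one_pos hp).trans_lt hn1⟩
      _ < ε / 2 + ε / 2 := ENNReal.add_lt_add ((hlux n).trans hn2) hηε
      _ = ε := ENNReal.add_halves ε

end Modular

section Bound

variable {N : ℕ} {Ω : Set (EuclideanSpace ℝ (Fin N))} {s P : ℝ}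
  {p : EuclideanSpace ℝ (Fin N) → EuclideanSpace ℝ (Fin N) → ℝ}
  {q γ u w : EuclideanSpace ℝ (Fin N) → ℝ}

/-! ### Energy estimate on superlevel sets -/

lemma abs_rpow_sub_two_mul_mul {a b r : ℝ} (hab : 0 ≤ a * b) (hba : |b| ≤ |a|) :
    |a| ^ (r - 2) * a * b = |a| ^ (r - 1) * |b| := by
  rcases eq_or_ne a 0 with rfl | ha
  · have : b = 0 := by simpa using hba
    simp [this]
  · have ha' : 0 < |a| := abs_pos.2 ha
    rw [mul_assoc, ← abs_of_nonneg hab, abs_mul, ← mul_assoc,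
      show r - 1 = (r - 2) + 1 by ring, Real.rpow_add_one ha'.ne']

lemma abs_rpow_le_rpow_sub_one_mul {a b r : ℝ} (hr : 1 ≤ r) (hba : |b| ≤ |a|) :
    |b| ^ r ≤ |a| ^ (r - 1) * |b| := by
  rcases eq_or_ne b 0 with rfl | hb
  · rw [abs_zero, Real.zero_rpow (by linarith), mul_zero]
  · have hb' : 0 < |b| := abs_pos.2 hb
    calc |b| ^ r = |b| ^ (r - 1) * |b| := by
          rw [← Real.rpow_add_one hb'.ne']; ring_nf
      _ ≤ _ := by gcongr

lemma rpow_sub_one_mul_abs_le {a b r : ℝ} (hba : |b| ≤ |a|) :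
    |a| ^ (r - 1) * |b| ≤ |a| ^ r := by
  rcases eq_or_ne a 0 with rfl | ha
  · have : b = 0 := by simpa using hba
    rw [this, abs_zero, mul_zero]
    positivity
  · have ha' : 0 < |a| := abs_pos.2 ha
    calc |a| ^ (r - 1) * |b| ≤ |a| ^ (r - 1) * |a| := by gcongr
      _ = |a| ^ r := by rw [← Real.rpow_add_one ha'.ne']; ring_nf

lemma abs_singular_term_le {lam a γ : ℝ} (hlam : 0 < lam) (hγ : 0 ≤ γ) (ha : 1 ≤ |a|) :
    |lam / (|a| ^ (γ - 1) * a)| ≤ lam := by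
  have ha0 : 0 < |a| := by linarith
  rw [abs_div, abs_of_pos hlam, abs_mul, abs_of_nonneg (Real.rpow_nonneg ha0.le _),
    ← Real.rpow_add_one ha0.ne', sub_add_cancel]
  exact div_le_self hlam.le (Real.one_le_rpow ha hγ)

/-- Testing the equation with `H ∘ u`, where `H` vanishes on `[-k, k]` and has slopes in `[0, 1]`:
on the support of `H ∘ u` the nonlinearity `g` vanishes and the singular term is at most `lam`. -/
lemma IsWeakSolution.gagliardo_comp_le (hΩ : MeasurableSet Ω)
    (hpc : ContinuousOn (Function.uncurry p) (closure Ω ×ˢ closure Ω))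
    (hp : ∀ x ∈ Ω, ∀ y ∈ Ω, 1 ≤ p x y ∧ p x y ≤ P)
    (hqc : ContinuousOn q Ω) (hq : ∀ x ∈ Ω, 1 ≤ q x) (hγ : ∀ x ∈ Ω, 0 ≤ γ x)
    {lam : ℝ} (hlam : 0 < lam) {g : EuclideanSpace ℝ (Fin N) → ℝ → ℝ} {k : ℝ} (hk : 1 ≤ k)
    (hg : ∀ x ∈ Ω, ∀ t, k ≤ |t| → g x t = 0) (hu : IsWeakSolution Ω s q p γ lam g u)
    {H : ℝ → ℝ} (hH : ContDiff ℝ ∞ H) (hHm : Monotone H) (hHL : ∀ a b, |H a - H b| ≤ |a - b|)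
    (hH0 : ∀ t, |t| ≤ k → H t = 0) :
    gagliardo Ω s p (H ∘ u) 1 ≤ ENNReal.ofReal lam * ∫⁻ x in Ω, ENNReal.ofReal |H (u x)| := by
  have hW : MemW₀ Ω s q p (H ∘ u) :=
    hu.1.comp_left hΩ hpc hp hqc hq hH (hH0 0 (by rw [abs_zero]; linarith)) hHL
  have heq := sub_eq_zero.1 (hu.2 _ hW).2
  have hum : AEMeasurable u (volume.restrict Ω) := hu.1.1.1.1.aemeasurable
  set B : EuclideanSpace ℝ (Fin N) × EuclideanSpace ℝ (Fin N) → ℝ := fun z =>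
    |u z.1 - u z.2| ^ (p z.1 z.2 - 2) * (u z.1 - u z.2) * ((H ∘ u) z.1 - (H ∘ u) z.2) /
        ‖z.1 - z.2‖ ^ ((N : ℝ) + s * p z.1 z.2) with hB
  have hBeq : ∀ z ∈ Ω ×ˢ Ω, B z = |u z.1 - u z.2| ^ (p z.1 z.2 - 1) *
      |(H ∘ u) z.1 - (H ∘ u) z.2| / ‖z.1 - z.2‖ ^ ((N : ℝ) + s * p z.1 z.2) := by
    intro z hz
    simp only [hB, Function.comp_apply]
    rw [abs_rpow_sub_two_mul_mul ?_ (hHL _ _)]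
    rcases le_total (u z.1) (u z.2) with h | h
    · exact mul_nonneg_of_nonpos_of_nonpos (sub_nonpos.2 h) (sub_nonpos.2 (hHm h))
    · exact mul_nonneg (sub_nonneg.2 h) (sub_nonneg.2 (hHm h))
  have hB0 : ∀ z ∈ Ω ×ˢ Ω, 0 ≤ B z := fun z hz => by rw [hBeq z hz]; positivity
  have hBm : AEMeasurable B (volume.restrict (Ω ×ˢ Ω)) := by
    have h1 := aemeasurable_exponent hΩ hpc
    have h2 := aemeasurable_increment hum
    have h3 : AEMeasurable (fun z : EuclideanSpace ℝ (Fin N) × EuclideanSpace ℝ (Fin N) =>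
        ‖z.1 - z.2‖) (volume.restrict (Ω ×ˢ Ω)) :=
      (continuous_fst.sub continuous_snd).norm.aemeasurable
    have h4 := aemeasurable_increment hW.1.1.1.aemeasurable
    exact ((((continuous_abs.measurable.comp_aemeasurable h2).pow (h1.sub_const 2)).mul h2).mul
      h4).div (h3.pow ((h1.const_mul s).const_add _))
  have hBfin : ∫⁻ z in Ω ×ˢ Ω, ENNReal.ofReal (B z) < ⊤ := by
    refine lt_of_le_of_lt (setLIntegral_mono' (hΩ.prod hΩ) fun z hz => ENNReal.ofReal_le_ofReal ?_)
      (hu.1.1.gagliardo_one_lt_top hΩ hp)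
    rw [hBeq z hz, Real.one_rpow, one_mul]
    have := rpow_sub_one_mul_abs_le (r := p z.1 z.2) (hHL (u z.1) (u z.2))
    exact div_le_div_of_nonneg_right this (by positivity)
  have hB0' : 0 ≤ᵐ[volume.restrict (Ω ×ˢ Ω)] B :=
    (ae_restrict_mem (hΩ.prod hΩ)).mono hB0
  have hBi : Integrable B (volume.restrict (Ω ×ˢ Ω)) :=
    ⟨hBm.aestronglyMeasurable, (hasFiniteIntegral_iff_ofReal hB0').2 hBfin⟩
  calc gagliardo Ω s p (H ∘ u) 1 ≤ ∫⁻ z in Ω ×ˢ Ω, ENNReal.ofReal (B z) := by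
        refine setLIntegral_mono' (hΩ.prod hΩ) fun z hz => ENNReal.ofReal_le_ofReal ?_
        rw [hBeq z hz, Real.one_rpow, one_mul]
        have := abs_rpow_le_rpow_sub_one_mul (hp _ hz.1 _ hz.2).1 (hHL (u z.1) (u z.2))
        exact div_le_div_of_nonneg_right this (by positivity)
    _ = ENNReal.ofReal (∫ z in Ω ×ˢ Ω, B z) := (ofReal_integral_eq_lintegral_ofReal hBi hB0').symm
    _ = ENNReal.ofReal (∫ x in Ω, (lam / (|u x| ^ (γ x - 1) * u x) + g x (u x)) * (H ∘ u) x) := by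
        rw [heq]
    _ ≤ ‖∫ x in Ω, (lam / (|u x| ^ (γ x - 1) * u x) + g x (u x)) * (H ∘ u) x‖ₑ := by
        rw [← ofReal_norm]; exact ENNReal.ofReal_le_ofReal (Real.le_norm_self _)
    _ ≤ ∫⁻ x in Ω, ‖(lam / (|u x| ^ (γ x - 1) * u x) + g x (u x)) * (H ∘ u) x‖ₑ :=
        enorm_integral_le_lintegral_enorm _
    _ ≤ ∫⁻ x in Ω, ENNReal.ofReal lam * ENNReal.ofReal |H (u x)| := by
        refine setLIntegral_mono' hΩ fun x hx => ?_
        rw [← ofReal_norm, ← ENNReal.ofReal_mul hlam.le, norm_mul, Real.norm_eq_abs,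
          Real.norm_eq_abs]
        refine ENNReal.ofReal_le_ofReal ?_
        rcases le_total |u x| k with h | h
        · simp [hH0 _ h]
        · rw [hg x hx _ h, add_zero]
          exact mul_le_mul_of_nonneg_right
            (abs_singular_term_le hlam (hγ x hx) (hk.trans h)) (abs_nonneg _)
    _ = _ := lintegral_const_mul' _ _ ENNReal.ofReal_ne_top

/-! ### Decay of the measure of superlevel sets -/

lemma rpow_sub_one_mul_sub_le {τ t r : ℝ} (hτ : 0 < τ) (hτ1 : τ ≤ 1) (hr : 1 ≤ r) (hrP : r ≤ P)
    (ht : τ ≤ t) : τ ^ (P - 1) * (t - τ) ≤ t ^ r := by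
  have ht0 : 0 < t := hτ.trans_le ht
  calc τ ^ (P - 1) * (t - τ) ≤ τ ^ (r - 1) * t := by
        refine mul_le_mul (Real.rpow_le_rpow_of_exponent_ge hτ hτ1 (by linarith)) (by linarith)
          (by linarith) (by positivity)
    _ ≤ t ^ (r - 1) * t := by
        gcongr
    _ = t ^ r := by rw [← Real.rpow_add_one ht0.ne']; ring_nf

/-- A nonlocal Poincaré-type bound. Let `w` vanish off `A = {k < |u|}`, and let `A` have at most half
of the measure that every ball of radius `r` centred in `Ω` has in common with `Ω`. Then the
interaction of `A` with its complement at distance less than `r` controls `∫ (|w| - τ)₊`. -/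
lemma mul_lintegral_le_gagliardo (hΩ : MeasurableSet Ω)
    (hpc : ContinuousOn (Function.uncurry p) (closure Ω ×ˢ closure Ω))
    (hp : ∀ x ∈ Ω, ∀ y ∈ Ω, 1 ≤ p x y ∧ p x y ≤ P) (hs : 0 ≤ s) {c r τ k : ℝ} (hc : 0 < c)
    (hr : 0 < r) (hr1 : r ≤ 1) (hτ : 0 < τ) (hτ1 : τ ≤ 1)
    (hdens : ∀ x ∈ Ω, ENNReal.ofReal (c * r ^ N) ≤ volume (Metric.ball x r ∩ Ω))
    (hu : AEMeasurable u (volume.restrict Ω)) (hw : AEMeasurable w (volume.restrict Ω))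
    (hA : volume.restrict Ω {x | k < |u x|} ≤ ENNReal.ofReal (c / 2 * r ^ N))
    (hw0 : ∀ x, |u x| ≤ k → w x = 0) :
    ENNReal.ofReal (τ ^ (P - 1) * (c / 2) * r ^ (-s)) *
      ∫⁻ x in Ω, ENNReal.ofReal (|w x| - τ) ≤ gagliardo Ω s p w 1 := by
  have hAm : NullMeasurableSet {x | k < |u x|} (volume.restrict Ω) :=
    nullMeasurableSet_lt aemeasurable_const (continuous_abs.measurable.comp_aemeasurable hu)
  have hm := (aemeasurable_gagliardo_integrand (s := s) hΩ hpc hw 1).ennreal_ofReal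
  rw [volume_restrict_prod] at hm
  rw [gagliardo, volume_restrict_prod, lintegral_prod _ hm,
    ← lintegral_const_mul' _ _ ENNReal.ofReal_ne_top]
  refine setLIntegral_mono' hΩ fun x hx => ?_
  rcases le_total (|w x|) τ with hwx | hwx
  · rw [ENNReal.ofReal_of_nonpos (sub_nonpos.2 hwx), mul_zero]; exact zero_le
  have hxA : k < |u x| := by
    by_contra! hcon
    rw [hw0 x hcon, abs_zero] at hwx
    linarith
  set T := Metric.ball x r \ {y | k < |u y|} with hT
  have hTm : NullMeasurableSet T (volume.restrict Ω) :=
    measurableSet_ball.nullMeasurableSet.diff hAm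
  have hTv : ENNReal.ofReal (c / 2 * r ^ N) ≤ volume.restrict Ω T := by
    calc ENNReal.ofReal (c / 2 * r ^ N)
        = ENNReal.ofReal (c * r ^ N) - ENNReal.ofReal (c / 2 * r ^ N) := by
          rw [← ENNReal.ofReal_sub _ (by positivity)]; congr 1; ring
      _ ≤ volume.restrict Ω (Metric.ball x r) - volume.restrict Ω {y | k < |u y|} := by
          refine tsub_le_tsub ?_ hA
          rw [Measure.restrict_apply measurableSet_ball]
          exact hdens x hx
      _ ≤ _ := le_measure_sdiff
  calc ENNReal.ofReal (τ ^ (P - 1) * (c / 2) * r ^ (-s)) * ENNReal.ofReal (|w x| - τ)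
      = ENNReal.ofReal (τ ^ (P - 1) * (|w x| - τ) * r ^ (-((N : ℝ) + s))) *
          ENNReal.ofReal (c / 2 * r ^ N) := by
        have h1 : r ^ (-s) = r ^ (-((N : ℝ) + s)) * r ^ N := by
          rw [← Real.rpow_natCast, ← Real.rpow_add hr]; congr 1; ring
        have h2 : 0 ≤ |w x| - τ := sub_nonneg.2 hwx
        rw [← ENNReal.ofReal_mul (by positivity), ← ENNReal.ofReal_mul (by positivity), h1]
        congr 1; ring
    _ ≤ ENNReal.ofReal (τ ^ (P - 1) * (|w x| - τ) * r ^ (-((N : ℝ) + s))) *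
          volume.restrict Ω T := by gcongr
    _ = ∫⁻ _ in T, ENNReal.ofReal (τ ^ (P - 1) * (|w x| - τ) * r ^ (-((N : ℝ) + s)))
          ∂(volume.restrict Ω) := (setLIntegral_const _ _).symm
    _ ≤ ∫⁻ y in T, ENNReal.ofReal (|w x - w y| ^ p x y /
          (1 ^ p x y * ‖x - y‖ ^ ((N : ℝ) + s * p x y))) ∂(volume.restrict Ω) := by
        refine lintegral_mono_ae ((ae_restrict_iff'₀ hTm).2 ?_)
        filter_upwards [ae_restrict_mem hΩ] with y hy hyT
        have hpxy := hp x hx y hy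
        have hyA : |u y| ≤ k := not_lt.1 hyT.2
        have hne : 0 < ‖x - y‖ := by
          refine norm_pos_iff.2 (sub_ne_zero.2 ?_)
          rintro rfl
          exact absurd hxA (not_lt.2 hyA)
        have hlt : ‖x - y‖ < r := by
          rw [← dist_eq_norm, dist_comm]; exact hyT.1
        rw [hw0 y hyA, sub_zero, Real.one_rpow, one_mul, div_eq_mul_inv]
        refine ENNReal.ofReal_le_ofReal (mul_le_mul
          (rpow_sub_one_mul_sub_le hτ hτ1 hpxy.1 hpxy.2 hwx) ?_ (by positivity) (by positivity))
        rw [Real.rpow_neg hr.le]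
        refine inv_anti₀ (by positivity) ?_
        -- at distances below one, lowering the exponent increases the power
        calc ‖x - y‖ ^ ((N : ℝ) + s * p x y) ≤ ‖x - y‖ ^ ((N : ℝ) + s) :=
              Real.rpow_le_rpow_of_exponent_ge hne (hlt.le.trans hr1) (by nlinarith)
          _ ≤ r ^ ((N : ℝ) + s) := by gcongr
    _ ≤ _ := setLIntegral_le_lintegral _ _

lemma lintegral_le_of_gagliardo_le (hΩ : MeasurableSet Ω)
    (hpc : ContinuousOn (Function.uncurry p) (closure Ω ×ˢ closure Ω))
    (hp : ∀ x ∈ Ω, ∀ y ∈ Ω, 1 ≤ p x y ∧ p x y ≤ P) (hs : 0 ≤ s) {c r τ k lam : ℝ} (hc : 0 < c)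
    (hr : 0 < r) (hr1 : r ≤ 1) (hτ : 0 < τ) (hτ1 : τ ≤ 1) (hlam : 0 < lam)
    (hdens : ∀ x ∈ Ω, ENNReal.ofReal (c * r ^ N) ≤ volume (Metric.ball x r ∩ Ω))
    (hu : AEMeasurable u (volume.restrict Ω)) (hw : AEMeasurable w (volume.restrict Ω))
    (hA : volume.restrict Ω {x | k < |u x|} ≤ ENNReal.ofReal (c / 2 * r ^ N))
    (hw0 : ∀ x, |u x| ≤ k → w x = 0) (hfin : ∫⁻ x in Ω, ENNReal.ofReal |w x| ≠ ⊤)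
    (henergy : gagliardo Ω s p w 1 ≤ ENNReal.ofReal lam * ∫⁻ x in Ω, ENNReal.ofReal |w x|)
    (hτr : 2 * lam ≤ τ ^ (P - 1) * (c / 2) * r ^ (-s)) :
    ∫⁻ x in Ω, ENNReal.ofReal |w x| ≤
      ENNReal.ofReal (2 * τ) * volume.restrict Ω {x | k < |u x|} := by
  have hAm : NullMeasurableSet {x | k < |u x|} (volume.restrict Ω) :=
    nullMeasurableSet_lt aemeasurable_const (continuous_abs.measurable.comp_aemeasurable hu)
  set I := ∫⁻ x in Ω, ENNReal.ofReal |w x| with hI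
  set J := ∫⁻ x in Ω, ENNReal.ofReal (|w x| - τ) with hJ
  set m := volume.restrict Ω {x | k < |u x|} with hm
  have hmfin : m ≠ ⊤ := ne_top_of_le_ne_top ENNReal.ofReal_ne_top hA
  have h1 : ENNReal.ofReal (2 * lam) * J ≤ ENNReal.ofReal lam * I :=
    calc ENNReal.ofReal (2 * lam) * J
        ≤ ENNReal.ofReal (τ ^ (P - 1) * (c / 2) * r ^ (-s)) * J := by gcongr
      _ ≤ _ := (mul_lintegral_le_gagliardo hΩ hpc hp hs hc hr hr1 hτ hτ1 hdens hu hw hA hw0).trans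
          henergy
  have h2 : I ≤ J + ENNReal.ofReal τ * m := by
    have : I ≤ ∫⁻ x in Ω, (ENNReal.ofReal (|w x| - τ) +
        {x | k < |u x|}.indicator (fun _ => ENNReal.ofReal τ) x) := by
      refine lintegral_mono fun x => ?_
      by_cases hx : k < |u x|
      · rw [indicator_of_mem (show x ∈ {x | k < |u x|} from hx)]
        refine le_trans (le_of_eq ?_) ENNReal.ofReal_add_le
        rw [sub_add_cancel]
      · simp [hw0 x (not_lt.1 hx)]
    refine this.trans (le_of_eq ?_)
    have hJm : AEMeasurable (fun x => ENNReal.ofReal (|w x| - τ)) (volume.restrict Ω) :=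
      ((continuous_abs.measurable.comp_aemeasurable hw).sub_const τ).ennreal_ofReal
    rw [lintegral_add_left' hJm, lintegral_indicator₀ hAm, setLIntegral_const]
  have hJI : J ≤ I := lintegral_mono fun x => ENNReal.ofReal_le_ofReal (by linarith)
  have hJfin : J ≠ ⊤ := ne_top_of_le_ne_top hfin hJI
  have h1' : 2 * lam * J.toReal ≤ lam * I.toReal := by
    have := ENNReal.toReal_mono (ENNReal.mul_ne_top ENNReal.ofReal_ne_top hfin) h1
    rwa [ENNReal.toReal_mul, ENNReal.toReal_mul, ENNReal.toReal_ofReal (by positivity),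
      ENNReal.toReal_ofReal hlam.le] at this
  have h2' : I.toReal ≤ J.toReal + τ * m.toReal := by
    have h3 := ENNReal.mul_ne_top (ENNReal.ofReal_ne_top (r := τ)) hmfin
    have := ENNReal.toReal_mono (ENNReal.add_ne_top.2 ⟨hJfin, h3⟩) h2
    rwa [ENNReal.toReal_add hJfin h3, ENNReal.toReal_mul, ENNReal.toReal_ofReal hτ.le] at this
  have h3 : J.toReal ≤ I.toReal / 2 := by
    have : lam * (2 * J.toReal) ≤ lam * I.toReal := by linarith
    linarith [le_of_mul_le_mul_left this hlam]
  rw [← ENNReal.ofReal_toReal hfin, ← ENNReal.ofReal_toReal hmfin,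
    ← ENNReal.ofReal_mul (by positivity)]
  exact ENNReal.ofReal_le_ofReal (by linarith)

/-- One step of the iteration: raising the level by a fixed multiple of `τ` divides the measure of
the superlevel set by `2 ^ N`, the factor by which the volume of a ball drops when its radius is
halved. -/
lemma measure_superlevel_step (hΩ : MeasurableSet Ω)
    (hpc : ContinuousOn (Function.uncurry p) (closure Ω ×ˢ closure Ω))
    (hp : ∀ x ∈ Ω, ∀ y ∈ Ω, 1 ≤ p x y ∧ p x y ≤ P) (hs : 0 ≤ s) {c r τ k lam : ℝ} (hc : 0 < c)
    (hr : 0 < r) (hr1 : r ≤ 1) (hτ : 0 < τ) (hτ1 : τ ≤ 1) (hlam : 0 < lam) (hk : 1 ≤ k)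
    (hdens : ∀ x ∈ Ω, ENNReal.ofReal (c * r ^ N) ≤ volume (Metric.ball x r ∩ Ω))
    (hu : AEMeasurable u (volume.restrict Ω)) (hfin : ∫⁻ x in Ω, ENNReal.ofReal |u x| < ⊤)
    (hA : volume.restrict Ω {x | k < |u x|} ≤ ENNReal.ofReal (c / 2 * r ^ N))
    (henergy : gagliardo Ω s p (truncation k τ ∘ u) 1 ≤
      ENNReal.ofReal lam * ∫⁻ x in Ω, ENNReal.ofReal |truncation k τ (u x)|)
    (hτr : 2 * lam ≤ τ ^ (P - 1) * (c / 2) * r ^ (-s)) :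
    volume.restrict Ω {x | k + (2 ^ (N + 1) + 1) * τ < |u x|} ≤
      ENNReal.ofReal (c / 2 * (r / 2) ^ N) := by
  have hwm : AEMeasurable (truncation k τ ∘ u) (volume.restrict Ω) :=
    (contDiff_truncation k τ).continuous.measurable.comp_aemeasurable hu
  have hwfin : ∫⁻ x in Ω, ENNReal.ofReal |(truncation k τ ∘ u) x| ≠ ⊤ := by
    refine (lt_of_le_of_lt (lintegral_mono fun x => ENNReal.ofReal_le_ofReal ?_) hfin).ne
    have := abs_truncation_sub_le k τ (u x) 0
    rwa [truncation_eq_zero (t := 0) hτ (by rw [abs_zero]; linarith), sub_zero, sub_zero] at this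
  have hI := lintegral_le_of_gagliardo_le hΩ hpc hp hs hc hr hr1 hτ hτ1 hlam hdens hu hwm hA
    (fun x hx => truncation_eq_zero hτ hx) hwfin henergy hτr
  have hmarkov := mul_meas_ge_le_lintegral₀
    (continuous_abs.measurable.comp_aemeasurable hwm).ennreal_ofReal
    (ENNReal.ofReal (2 ^ (N + 1) * τ))
  have hsub : volume.restrict Ω {x | k + (2 ^ (N + 1) + 1) * τ < |u x|} ≤
      volume.restrict Ω {x | ENNReal.ofReal (2 ^ (N + 1) * τ) ≤
        ENNReal.ofReal |(truncation k τ ∘ u) x|} := by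
    refine measure_mono fun x hx => ENNReal.ofReal_le_ofReal ?_
    have h1 := abs_sub_le_abs_truncation hk hτ (u x)
    have h2 : k + (2 ^ (N + 1) + 1) * τ < |u x| := hx
    simp only [Function.comp_apply]
    linarith
  have hpos : (0 : ℝ) < 2 ^ (N + 1) * τ := by positivity
  refine (ENNReal.mul_le_mul_iff_right (ENNReal.ofReal_pos.2 hpos).ne' ENNReal.ofReal_ne_top).1 ?_
  calc ENNReal.ofReal (2 ^ (N + 1) * τ) *
        volume.restrict Ω {x | k + (2 ^ (N + 1) + 1) * τ < |u x|}
      ≤ ENNReal.ofReal (2 * τ) * ENNReal.ofReal (c / 2 * r ^ N) :=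
        (mul_le_mul_right hsub _).trans (hmarkov.trans (hI.trans (mul_le_mul_right hA _)))
    _ = ENNReal.ofReal (2 ^ (N + 1) * τ) * ENNReal.ofReal (c / 2 * (r / 2) ^ N) := by
        rw [← ENNReal.ofReal_mul (by positivity), ← ENNReal.ofReal_mul (by positivity), div_pow,
          pow_succ]
        congr 1
        field_simp

lemma exists_measure_superlevel_le (hu : AEMeasurable u (volume.restrict Ω))
    (hfin : ∫⁻ x in Ω, ENNReal.ofReal |u x| < ⊤) (k₀ : ℝ) {ε : ℝ} (hε : 0 < ε) :
    ∃ k ≥ k₀, volume.restrict Ω {x | k < |u x|} ≤ ENNReal.ofReal ε := by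
  set I := ∫⁻ x in Ω, ENNReal.ofReal |u x| with hI
  set k := max k₀ (I.toReal / ε + 1) with hk
  have hk0 : 0 < k := lt_max_of_lt_right (by positivity)
  refine ⟨k, le_max_left _ _, ?_⟩
  have hmarkov := mul_meas_ge_le_lintegral₀
    (continuous_abs.measurable.comp_aemeasurable hu).ennreal_ofReal (ENNReal.ofReal k)
  have hsub : volume.restrict Ω {x | k < |u x|} ≤
      volume.restrict Ω {x | ENNReal.ofReal k ≤ ENNReal.ofReal |u x|} :=
    measure_mono fun x hx => ENNReal.ofReal_le_ofReal (le_of_lt hx)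
  refine (ENNReal.mul_le_mul_iff_right (ENNReal.ofReal_pos.2 hk0).ne' ENNReal.ofReal_ne_top).1 ?_
  calc ENNReal.ofReal k * volume.restrict Ω {x | k < |u x|} ≤ I :=
        (mul_le_mul_right hsub _).trans hmarkov
    _ = ENNReal.ofReal I.toReal := (ENNReal.ofReal_toReal hfin.ne).symm
    _ ≤ ENNReal.ofReal (k * ε) := by
        refine ENNReal.ofReal_le_ofReal ?_
        have : I.toReal / ε + 1 ≤ k := le_max_right _ _
        have h2 : I.toReal / ε ≤ k := by linarith
        rwa [div_le_iff₀ hε] at h2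
    _ = _ := ENNReal.ofReal_mul hk0.le

/-- Boundedness from the energy inequalities for all truncations at large levels. With radii
`r₁ / 2 ^ n` and truncation widths proportional to `(r₁ / 2 ^ n) ^ (s / (P - 1))`, the levels of the
iteration increase to a finite limit. -/
lemma exists_ae_abs_le_of_gagliardo_le (hΩ : MeasurableSet Ω)
    (hpc : ContinuousOn (Function.uncurry p) (closure Ω ×ˢ closure Ω))
    (hp : ∀ x ∈ Ω, ∀ y ∈ Ω, 1 ≤ p x y ∧ p x y ≤ P) (hP : 1 < P) (hN : N ≠ 0) (hs : 0 < s)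
    {c r₀ lam k₀ : ℝ} (hc : 0 < c) (hr₀ : 0 < r₀) (hlam : 0 < lam) (hk₀ : 1 ≤ k₀)
    (hdens : ∀ x ∈ Ω, ∀ r, 0 < r → r ≤ r₀ →
      ENNReal.ofReal (c * r ^ N) ≤ volume (Metric.ball x r ∩ Ω))
    (hu : AEMeasurable u (volume.restrict Ω)) (hfin : ∫⁻ x in Ω, ENNReal.ofReal |u x| < ⊤)
    (henergy : ∀ k ≥ k₀, ∀ τ > 0, gagliardo Ω s p (truncation k τ ∘ u) 1 ≤
      ENNReal.ofReal lam * ∫⁻ x in Ω, ENNReal.ofReal |truncation k τ (u x)|) :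
    ∃ M : ℝ, ∀ᵐ x ∂(volume.restrict Ω), |u x| ≤ M := by
  set θ := s / (P - 1) with hθ
  have hP0 : 0 < P - 1 := sub_pos.2 hP
  have hθ0 : 0 < θ := div_pos hs hP0
  set K := (4 * lam / c) ^ (P - 1)⁻¹ with hK
  have hK0 : 0 < K := by positivity
  -- the initial radius is chosen so small that the width `K * r₁ ^ θ` is at most one
  set r₁ := min (min r₀ 1) (K⁻¹ ^ θ⁻¹) with hr₁
  have hr₁0 : 0 < r₁ := lt_min (lt_min hr₀ one_pos) (by positivity)
  have hr₁r₀ : r₁ ≤ r₀ := (min_le_left _ _).trans (min_le_left _ _)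
  have hr₁1 : r₁ ≤ 1 := (min_le_left _ _).trans (min_le_right _ _)
  have hKr₁ : K * r₁ ^ θ ≤ 1 := by
    have : r₁ ^ θ ≤ K⁻¹ := by
      calc r₁ ^ θ ≤ (K⁻¹ ^ θ⁻¹) ^ θ := by gcongr; exact min_le_right _ _
        _ = K⁻¹ := Real.rpow_inv_rpow (by positivity) hθ0.ne'
    calc K * r₁ ^ θ ≤ K * K⁻¹ := by gcongr
      _ = 1 := mul_inv_cancel₀ hK0.ne'
  obtain ⟨k₁, hk₁, hk₁A⟩ := exists_measure_superlevel_le hu hfin k₀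
    (ε := c / 2 * r₁ ^ N) (by positivity)
  set r : ℕ → ℝ := fun n => r₁ / 2 ^ n with hr
  set τ : ℕ → ℝ := fun n => K * r n ^ θ with hτ
  set k : ℕ → ℝ := fun n => k₁ + ∑ i ∈ Finset.range n, (2 ^ (N + 1) + 1) * τ i with hk
  have hr0 : ∀ n, 0 < r n := fun n => by positivity
  have hrr₁ : ∀ n, r n ≤ r₁ := fun n => div_le_self hr₁0.le (one_le_pow₀ one_le_two)
  have hτ0 : ∀ n, 0 < τ n := fun n => by have := hr0 n; positivity
  have hτ1 : ∀ n, τ n ≤ 1 := fun n => by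
    refine le_trans ?_ hKr₁
    have := hr0 n
    have := hrr₁ n
    simp only [hτ]
    gcongr
  have hkk₁ : ∀ n, k₁ ≤ k n := fun n =>
    le_add_of_nonneg_right (Finset.sum_nonneg fun i _ => by have := hτ0 i; positivity)
  have hτr : ∀ n, 2 * lam ≤ τ n ^ (P - 1) * (c / 2) * r n ^ (-s) := fun n => by
    have h1 : τ n ^ (P - 1) = 4 * lam / c * r n ^ s := by
      simp only [hτ]
      rw [Real.mul_rpow hK0.le (Real.rpow_nonneg (hr0 n).le _), ← Real.rpow_mul (hr0 n).le, hK,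
        Real.rpow_inv_rpow (by positivity) hP0.ne', hθ, div_mul_cancel₀ _ hP0.ne']
    have h2 : r n ^ s * r n ^ (-s) = 1 := by
      rw [← Real.rpow_add (hr0 n), add_neg_cancel, Real.rpow_zero]
    refine le_of_eq ?_
    calc 2 * lam = 2 * lam * (r n ^ s * r n ^ (-s)) := by rw [h2, mul_one]
      _ = 4 * lam / c * r n ^ s * (c / 2) * r n ^ (-s) := by field_simp; ring
      _ = _ := by rw [h1]
  have hdecay : ∀ n, volume.restrict Ω {x | k n < |u x|} ≤
      ENNReal.ofReal (c / 2 * r n ^ N) := by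
    intro n
    induction n with
    | zero => simpa [hk, hr] using hk₁A
    | succ n ih =>
      have hstep := measure_superlevel_step hΩ hpc hp hs.le hc (hr0 n) ((hrr₁ n).trans hr₁1)
        (hτ0 n) (hτ1 n) hlam (hk₀.trans (hk₁.trans (hkk₁ n)))
        (fun x hx => hdens x hx _ (hr0 n) ((hrr₁ n).trans hr₁r₀)) hu hfin ih
        (henergy _ (hk₁.trans (hkk₁ n)) _ (hτ0 n)) (hτr n)
      have h1 : k (n + 1) = k n + (2 ^ (N + 1) + 1) * τ n := by
        simp only [hk]; rw [Finset.sum_range_succ, add_assoc]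
      have h2 : r (n + 1) = r n / 2 := by
        simp only [hr]; rw [pow_succ, div_div]
      rwa [h1, h2]
  have hsumm : Summable fun i => (2 ^ (N + 1) + 1) * τ i := by
    have hgeo : ∀ i, (2 ^ (N + 1) + 1) * τ i =
        (2 ^ (N + 1) + 1) * (K * r₁ ^ θ) * ((1 / 2 : ℝ) ^ θ) ^ i := fun i => by
      simp only [hτ, hr]
      rw [div_eq_mul_one_div, ← one_div_pow, Real.mul_rpow hr₁0.le (by positivity),
        Real.rpow_pow_comm (by norm_num)]
      ring
    simp_rw [hgeo]
    exact (summable_geometric_of_lt_one (by positivity)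
      (Real.rpow_lt_one (by norm_num) (by norm_num) hθ0)).mul_left _
  set M := k₁ + ∑' i, (2 ^ (N + 1) + 1) * τ i with hM
  have hkM : ∀ n, k n ≤ M := fun n => by
    simp only [hk, hM]
    gcongr
    exact hsumm.sum_le_tsum _ fun i _ => by have := hτ0 i; positivity
  refine ⟨M, ?_⟩
  have hzero : volume.restrict Ω {x | M < |u x|} = 0 := by
    refine le_antisymm ?_ zero_le
    have hrlim : Filter.Tendsto r Filter.atTop (𝓝 0) :=
      tendsto_const_nhds.div_atTop (tendsto_pow_atTop_atTop_of_one_lt one_lt_two)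
    have hlim : Filter.Tendsto (fun n => ENNReal.ofReal (c / 2 * r n ^ N)) Filter.atTop (𝓝 0) := by
      simpa [hN] using ENNReal.tendsto_ofReal ((hrlim.pow N).const_mul (c / 2))
    exact ge_of_tendsto' hlim fun n =>
      (measure_mono fun x hx => (hkM n).trans_lt hx).trans (hdecay n)
  rw [ae_iff]
  simpa only [not_le] using hzero

end Bound

end

end VarExpFrac

theorem lemma4p5 {N : ℕ} (hN : 2 ≤ N) (Ω : Set (EuclideanSpace ℝ (Fin N)))
    (hΩ : VarExpFrac.IsSmoothBoundedDomain Ω)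
    (s : ℝ) (hs0 : 0 < s) (hs1 : s < 1)
    (p : EuclideanSpace ℝ (Fin N) → EuclideanSpace ℝ (Fin N) → ℝ)
    (hP : VarExpFrac.AssumptionP Ω p)
    (hsp : ∀ x ∈ closure Ω, ∀ y ∈ closure Ω, s * p x y < N)
    (q : EuclideanSpace ℝ (Fin N) → ℝ) (hQ : VarExpFrac.AssumptionQ Ω q)
    (γ : EuclideanSpace ℝ (Fin N) → ℝ) (hG : VarExpFrac.AssumptionG Ω γ)
    (f : EuclideanSpace ℝ (Fin N) → ℝ → ℝ) (α : EuclideanSpace ℝ (Fin N) → ℝ) (δ δ' : ℝ)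
    (hF : VarExpFrac.AssumptionF Ω p γ f α δ δ')
    (lam : ℝ) (hlam : 0 < lam)
    (l : ℝ) (hl0 : 0 < l) (hl : l ≤ 1 / 2 * min δ δ')
    (ξ : ℝ → ℝ) (hξ : VarExpFrac.IsCutoff l ξ)
    (u : EuclideanSpace ℝ (Fin N) → ℝ)
    (hu : VarExpFrac.IsWeakSolution Ω s q p γ lam (fun x t => f x t * ξ t) u) :
    MeasureTheory.MemLp u ⊤ (MeasureTheory.volume.restrict Ω) := by
  have hm : MeasurableSet Ω := hΩ.isOpen.measurableSet
  obtain ⟨P, hP1, hPb⟩ := hP.exists_bounds hΩ.isBounded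
  have hq : ∀ x ∈ Ω, 1 ≤ q x := fun x hx =>
    hQ.one_lt.le.trans (VarExpFrac.lo_le hΩ.isBounded hQ.continuousOn (subset_closure hx))
  have hγ : ∀ x ∈ Ω, 0 ≤ γ x := fun x hx =>
    hG.pos.le.trans (VarExpFrac.lo_le hΩ.isBounded hG.continuousOn (subset_closure hx))
  have hum : AEMeasurable u (MeasureTheory.volume.restrict Ω) := hu.1.1.1.1.aemeasurable
  obtain ⟨c, hc, r₀, hr₀, hdens⟩ := hΩ.exists_measure_density
  obtain ⟨M, hM⟩ := VarExpFrac.exists_ae_abs_le_of_gagliardo_le (s := s) (k₀ := max 1 (2 * l)) hm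
    hP.continuousOn hPb hP1 (by omega) hs0 hc hr₀ hlam (le_max_left _ _) hdens hum
    (hu.1.1.1.lintegral_abs_lt_top hm hΩ.isBounded.measure_lt_top.ne hq) fun k hk τ hτ =>
      hu.gagliardo_comp_le hm hP.continuousOn hPb (hQ.continuousOn.mono subset_closure) hq hγ hlam
        ((le_max_left _ _).trans hk)
        (fun x _ t ht => by
          rw [hξ.eq_zero t (((le_max_right _ _).trans hk).trans ht), mul_zero])
        (VarExpFrac.contDiff_truncation k τ) (VarExpFrac.monotone_truncation k τ)
        (VarExpFrac.abs_truncation_sub_le k τ)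
        (fun t ht => VarExpFrac.truncation_eq_zero hτ ht)
  exact MeasureTheory.memLp_top_of_bound hu.1.1.1.1 M hM
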